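/- **Theorem (Type preservation).** Fix a System $\mathrm F^\epsilon$ label context $\Sigma$ (a finite list of entries $\ell:A\twoheadrightarrow B$) all of whose types $A,B$ are closed and well-formed value types, and use $\llbracket\Sigma\rrbracket$ as the label context of $\mathrm{Met}(\mathcal R_{\mathsf{scp}})$. Then: 1. if $\Gamma\vdash M:A\mid E$ is derivable in System $\mathrm F^\epsilon$, then $\llbracket\Gamma\rrbracket\vdash\llbracket M\rrbracket:\llbracket A\rrbracket\ @\ \llbracket E\rrbracket$ is derivable in $\mathrm{Met}(\mathcal R_{\mathsf{scp}})$; 2. if $\Gamma\vdash V:A$ is derivable in System $\mathrm F^\epsilon$, then $\llbracket\Gamma\rrbracket\vdash\llbracket V\rrbracket:\llbracket A\rrbracket\ @\ \llbracket E\rrbracket$ is derivable for every effect row $E$ with $\Gamma\vdash E:\mathsf{Effect}$, in particular for $E=\cdot$. Here $\llbracket M\rrbracket$, $\llbracket V\rrbracket$ are defined on typing derivations (the translation is type-directed); the statement is for every derivation. The notions are as follows; terms and types are taken up to renaming of bound variables. **System $\mathrm F^\epsilon$.** Types $A,B::=1\mid\alpha\mid A\to^E B\mid\forall\alpha^K.A$;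 rows $E::=\cdot\mid\varepsilon\mid\ell,E$; kinds $K::=\mathsf{Effect}\mid\mathsf{Value}$; contexts $\Gamma::=\cdot\mid\Gamma,x:A\mid\Gamma,\alpha:K$, ordered. Values $V,W::=()\mid x\mid\lambda^Ex^A.M\mid\Lambda\alpha^K.V\mid\mathbf{handler}\,\{\ell\,p\,r\mapsto N\}$; computations $M,N::=\mathbf{return}\,V\mid V\,W\mid V\,T\mid\mathbf{do}\,\ell\,V\mid\mathbf{let}\,x=M\,\mathbf{in}\,N\mid\mathbf{handle}\,M\,\mathbf{with}\,\{\ell\,p\,r\mapsto N\}$ (the last is the runtime construct), with $T$ a type or a row. Rows are taken modulo reordering of distinct labels, and types modulo this equivalence of the rows in them (conversion rules). All contexts, types and rows in judgements are well-scoped and well-kinded, with labels from $\Sigma$. Typing rules: - $()$ has type $1$; $x:A$ if $\Gamma\ni x:A$; $\lambda^Ex^A.M:A\to^EB$ if $\Gamma,x:A\vdash M:B\mid E$; $\Lambda\alpha^K.V:\forall\alpha^K.A$ if $\Gamma,\alpha:K\vdash V:A$; - $\mathbf{handler}\{\ell\,p\,r\mapsto N\}:(1\to^{\ell,E}A)\to^EA$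 if $\Sigma\ni\ell:A'\twoheadrightarrow B'$ and $\Gamma,p:A',r:B'\to^EA\vdash N:A\mid E$; - $\mathbf{return}\,V:A\mid E$ if $V:A$; $\mathbf{let}\,x=M\,\mathbf{in}\,N:B\mid E$ if $M:A\mid E$ and $\Gamma,x:A\vdash N:B\mid E$; $V\,W:B\mid E$ if $V:A\to^EB$ and $W:A$; $V\,T:B[T/\alpha]\mid E$ if $V:\forall\alpha^K.B$ and $T:K$; $\mathbf{do}\,\ell\,V:B\mid\ell,E$ if $\Sigma\ni\ell:A\twoheadrightarrow B$ and $V:A$; - $\mathbf{handle}\,M\,\mathbf{with}\,\{\ell\,p\,r\mapsto N\}:A\mid E$ if $M:A\mid\ell,E$ and $\Sigma,N$ are as for $\mathbf{handler}$. **$\mathrm{Met}(\mathcal R_{\mathsf{scp}})$.** Extensions $D$ and effect contexts $E,F$ are lists of labels and effect variables. $D$ is well-formed if it consists of declared labels (repetitions allowed); $E$ is well-formed if it is a well-formed extension followed by at most one declared effect variable. $\equiv$ is equality modulo reordering of distinct labels, and $E\leqslant F$ means that $E,E'$ is well-formed and $E,E'\equiv F$ for some $E'$. Modalities are $[E]$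 (absolute) and $\langle D\rangle$ (extension), with $[E](F)=E$, $\langle D\rangle(F)=D,F$, $\mu\circ[E]=[E]$, $[E]\circ\langle D\rangle=[D,E]$, $\langle D_1\rangle\circ\langle D_2\rangle=\langle D_2,D_1\rangle$. The transformation $\mu\Rightarrow\nu\ @\ F$ holds if $\mu=[E]$ and $E\leqslant\nu(F)$, or if $\mu=\langle D_1\rangle$, $\nu=\langle D_2\rangle$ and $D_1,F'\leqslant D_2,F'$ for all $F'$ with $F\leqslant F'$. Types $A::=1\mid\alpha\mid A\to B\mid\Box_\mu A\mid\forall\alpha^K.A$ have kinds $\mathsf{Abs}\le\mathsf{Any}$: $1:\mathsf{Abs}$; $A\to B:\mathsf{Any}$; $\Box_{[E]}A:\mathsf{Abs}$; $\Box_{\langle D\rangle}A$ and $\forall\alpha^K.A$ have the kinds of $A$; variables have their declared kinds. Effect variables have kind $\mathsf{Effect}$. For $\ell:A\twoheadrightarrow B$ both types have kind $\mathsf{Abs}$. Contexts are ordered lists of entries $\alpha:K$, $x:_{\mu_F}A$, locks $\mathsf{lock}_{\mu_F}$ and $\ell:A\twoheadrightarrow B$; $\Gamma@E$ says that the types in $\Gamma$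 are well-kinded in their prefixes and that the indices fit ($\cdot@E$; $\Gamma@F$ gives $(\Gamma,x:_{\mu_F}A)@F$ and $(\Gamma,\mathsf{lock}_{\mu_F})@\mu(F)$; other entries keep the index), and local labels are fresh. $\mathrm{locks}(\Gamma)$ is the composition of the modalities of the locks of $\Gamma$. Contexts are identified up to $\mathsf{lock}_{\langle\rangle}=\cdot$ and $\mathsf{lock}_{\mu_F},\mathsf{lock}_{\nu_{F'}}=\mathsf{lock}_{(\mu\circ\nu)_F}$; types, effect contexts and indices are taken up to $\equiv$. A judgement $\Gamma\vdash M:A\ @\ E$ presupposes that $\llbracket\Sigma\rrbracket$, $E$ and $A$ are well-formed and $\Gamma@E$; $x:A$ abbreviates $x:_{\langle\rangle_E}A$ for the ambient $E$. Typing rules: - $\Gamma,x:_{\mu_F}A,\Gamma'\vdash x:A\ @\ E$ if $A:\mathsf{Abs}$ or $\mu\Rightarrow\mathrm{locks}(\Gamma')\ @\ F$; - $\mathbf{mod}_\mu V:\Box_\mu A\ @\ F$ if $\Gamma,\mathsf{lock}_{\mu_F}\vdash V:A\ @\ \mu(F)$; - $\mathbf{let}_\nu\,\mathbf{mod}_\mu\,x=V\,\mathbf{in}\,M:B\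 @\ F$ if $\Gamma,\mathsf{lock}_{\nu_F}\vdash V:\Box_\mu A\ @\ \nu(F)$ and $\Gamma,x:_{(\nu\circ\mu)_F}A\vdash M:B\ @\ F$; - the usual rules, at a fixed $E$, for $()$, $\lambda x^A.M$, $M\,N$, $\Lambda\alpha^K.V$ and $M\,T$; - $\mathbf{do}\,\ell\,N:B\ @\ \ell,E$ if $\ell:A\twoheadrightarrow B$ is in $\llbracket\Sigma\rrbracket$ or $\Gamma$ and $N:A\ @\ \ell,E$; $\mathbf{local}\,\ell:A\twoheadrightarrow B\,\mathbf{in}\,M:A'\ @\ E$ if $\Gamma,\ell:A\twoheadrightarrow B\vdash M:A'\ @\ E$; - $\mathbf{handle}^\mu M\,\mathbf{with}\,\{\mathbf{return}\,x\mapsto N,\ \ell\,p\,r\mapsto N'\}:B\ @\ F$ if, with $E=\mu(F)$ and $\ell:A'\twoheadrightarrow B'$ in $\llbracket\Sigma\rrbracket$ or $\Gamma$: $\mu\Rightarrow\langle\rangle\ @\ F$, $\mu\Rightarrow\mu\circ\mu\ @\ F$, $\Gamma,\mathsf{lock}_{\mu_F},\mathsf{lock}_{\langle\ell\rangle_E}\vdash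 M:A\ @\ \ell,E$, $\Gamma,\mathsf{lock}_{\mu_F},x:\Box_{\mu\circ\langle\ell\rangle}A\vdash N:B\ @\ E$ and $\Gamma,\mathsf{lock}_{\mu_F},p:A',r:\Box_\mu(B'\to B)\vdash N':B\ @\ E$. In $\mathbf{mod}$, in the bound term of $\mathbf{let\,mod}$ and under $\Lambda$, $V$ is a value: $V,W::=()\mid x\mid\lambda x^A.M\mid\Lambda\alpha^K.V\mid\mathbf{mod}_\mu V\mid V\,T\mid\mathbf{let}_\nu\,\mathbf{mod}_\mu\,x=V\,\mathbf{in}\,W$. **Translation.** $\llbracket\mathsf{Effect}\rrbracket=\mathsf{Effect}$, $\llbracket\mathsf{Value}\rrbracket=\mathsf{Abs}$; rows are translated to the same lists; $\llbracket1\rrbracket=1$, $\llbracket\alpha\rrbracket=\alpha$, $\llbracket A\to^EB\rrbracket=\Box_{[\llbracket E\rrbracket]}(\llbracket A\rrbracket\to\llbracket B\rrbracket)$, $\llbracket\forall\alpha^K.A\rrbracket=\forall\alpha^{\llbracket K\rrbracket}.\llbracket A\rrbracket$; contexts and label contexts are translated entrywise, a variable of $\llbracket\Gamma\rrbracket$ being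 tagged with $\langle\rangle$ at the effect context of the judgement. Writing $\mathbf{let\,mod}$ for $\mathbf{let}_{\langle\rangle}\,\mathbf{mod}$ and $\mathbf{let}\,x=M\,\mathbf{in}\,N$ for $(\lambda x.N)\,M$: the translation commutes with $()$, $x$, $\Lambda$, type application, $\mathbf{do}$ and $\mathbf{let}$; conversions are ignored; $\llbracket\mathbf{return}\,V\rrbracket=\llbracket V\rrbracket$; $\llbracket\lambda^Ex^A.M\rrbracket=\mathbf{mod}_{[\llbracket E\rrbracket]}(\lambda x^{\llbracket A\rrbracket}.\llbracket M\rrbracket)$; for $V:A\to^EB$, $\llbracket V\,W\rrbracket=\mathbf{let\,mod}_{[\llbracket E\rrbracket]}\,x=\llbracket V\rrbracket\,\mathbf{in}\,x\,\llbracket W\rrbracket$; for $H=\{\ell\,p\,r\mapsto N\}$ at the types above, $\llbracket H\rrbracket=\{\mathbf{return}\,x\mapsto\mathbf{let\,mod}_{[\llbracket\ell,E\rrbracket]}\,x'=x\,\mathbf{in}\,x',\ \ell\,p\,r\mapsto\llbracket N\rrbracket\}$, $\llbracket\mathbf{handle}\,M\,\mathbf{with}\,H\rrbracket=\mathbf{handle}^{[\llbracket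 E\rrbracket]}\,\llbracket M\rrbracket\,\mathbf{with}\,\llbracket H\rrbracket$ and $\llbracket\mathbf{handler}\,H\rrbracket=\mathbf{mod}_{[\llbracket E\rrbracket]}\bigl(\lambda f.\,\mathbf{handle}^{[\llbracket E\rrbracket]}\,(\mathbf{let\,mod}_{[\llbracket\ell,E\rrbracket]}\,f'=f\,\mathbf{in}\,f'\,())\,\mathbf{with}\,\llbracket H\rrbracket\bigr)$. -/

import Mathlib

/-!
Two calculi and a translation between them.

* `Feps` is System F^ε, a fine-grain call-by-value row-based effect calculus.
* `Met` is the modal effect calculus Met(R_scp), for the effect theory of scoped rows.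
* `Transl` is the type-directed translation from the first to the second.

Binding is by de Bruijn indices, with one index space for term variables and one for type
variables (which range over value types and over effects). Operation labels are names.
Contexts are ordered lists whose head is the most recent entry. All types in a context are
scoped over all type variables of that context, so that adding a type variable shifts the
entries that are already there.
-/

/-- Operation labels. -/
abbrev Label := ℕ

/-- A renaming under one more binder. -/
def liftRen (ρ : ℕ → ℕ) : ℕ → ℕ
  | 0 => 0
  | i + 1 => ρ i + 1

/-- What the well-formedness of a type depends on: the declared labels, and for each type
variable its kind, or `none` for a variable that is declared only further to the right. -/
structure Scope (K : Type) where
  labels : List Label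
  kinds : List (Option K)

/-- `Ω ∋ α : κ`. -/
def Scope.HasKind {K : Type} (Ω : Scope K) (i : ℕ) (κ : K) : Prop :=
  Ω.kinds[i]? = some (some κ)

/-- `Ω, α : κ`. -/
def Scope.push {K : Type} (Ω : Scope K) (κ : K) : Scope K :=
  ⟨Ω.labels, some κ :: Ω.kinds⟩

/-! ## System F^ε -/

namespace Feps

inductive Kind : Type
  | effect
  | value

/-- Effect rows `E ::= · | ε | ℓ, E`. -/
inductive Row : Type
  | nil
  | var (i : ℕ)
  | cons (l : Label) (E : Row)

/-- Value types `A ::= 1 | α | A →^E B | ∀ α^K. A`. -/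
inductive Ty : Type
  | unit
  | var (i : ℕ)
  | arr (A : Ty) (E : Row) (B : Ty)
  | all (κ : Kind) (A : Ty)

/-- Arguments of type applications: value types and effect rows. -/
inductive TyArg : Type
  | ty (A : Ty)
  | row (E : Row)

def Row.rename (ρ : ℕ → ℕ) : Row → Row
  | .nil => .nil
  | .var i => .var (ρ i)
  | .cons l E => .cons l (E.rename ρ)

def Ty.rename : (ℕ → ℕ) → Ty → Ty
  | _, .unit => .unit
  | ρ, .var i => .var (ρ i)
  | ρ, .arr A E B => .arr (A.rename ρ) (E.rename ρ) (B.rename ρ)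
  | ρ, .all κ A => .all κ (A.rename (liftRen ρ))

/-- Simultaneous substitutions for type variables: `ty` acts on occurrences as value types,
`row` on occurrences as effect variables. -/
structure Subst where
  ty : ℕ → Ty
  row : ℕ → Row

def Subst.lift (σ : Subst) : Subst where
  ty
    | 0 => .var 0
    | i + 1 => (σ.ty i).rename Nat.succ
  row
    | 0 => .var 0
    | i + 1 => (σ.row i).rename Nat.succ

def Row.subst (σ : Subst) : Row → Row
  | .nil => .nil
  | .var i => σ.row i
  | .cons l E => .cons l (E.subst σ)

def Ty.subst : Subst → Ty → Ty
  | _, .unit => .unit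
  | σ, .var i => σ.ty i
  | σ, .arr A E B => .arr (A.subst σ) (E.subst σ) (B.subst σ)
  | σ, .all κ A => .all κ (A.subst σ.lift)

/-- The substitution `[T/α]` for the most recent type variable. Its value at the occurrences
of `α` whose sort differs from that of `T` is arbitrary: well-kinded types have none. -/
def TyArg.toSubst : TyArg → Subst
  | .ty A =>
    { ty := fun | 0 => A | i + 1 => .var i
      row := fun | 0 => .nil | i + 1 => .var i }
  | .row E =>
    { ty := fun | 0 => .unit | i + 1 => .var i
      row := fun | 0 => E | i + 1 => .var i }

/-- `A[T/α]`. -/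
def Ty.inst (A : Ty) (T : TyArg) : Ty := A.subst T.toSubst

/-- Equivalence of scoped rows: equality modulo reordering of distinct labels. -/
inductive RowEquiv : Row → Row → Prop
  | refl (E : Row) : RowEquiv E E
  | trans {E₁ E₂ E₃ : Row} : RowEquiv E₁ E₂ → RowEquiv E₂ E₃ → RowEquiv E₁ E₃
  | cons (l : Label) {E E' : Row} : RowEquiv E E' → RowEquiv (.cons l E) (.cons l E')
  | swap {l l' : Label} (E : Row) : l ≠ l' →
      RowEquiv (.cons l (.cons l' E)) (.cons l' (.cons l E))

/-- Equality of types modulo equivalence of the rows in them. -/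
inductive TyEquiv : Ty → Ty → Prop
  | unit : TyEquiv .unit .unit
  | var (i : ℕ) : TyEquiv (.var i) (.var i)
  | arr {A A' B B' : Ty} {E E' : Row} : TyEquiv A A' → RowEquiv E E' → TyEquiv B B' →
      TyEquiv (.arr A E B) (.arr A' E' B')
  | all (κ : Kind) {A A' : Ty} : TyEquiv A A' → TyEquiv (.all κ A) (.all κ A')

/-- Label contexts; an entry `(ℓ, A, B)` stands for `ℓ : A ↠ B`. -/
abbrev Sig := List (Label × Ty × Ty)

inductive Entry : Type
  | var (A : Ty)
  | tvar (κ : Kind)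

abbrev Ctx := List Entry

def Entry.shift : Entry → Entry
  | .var A => .var (A.rename Nat.succ)
  | .tvar κ => .tvar κ

/-- `Γ, α : κ`. -/
def Ctx.bindT (Γ : Ctx) (κ : Kind) : Ctx := .tvar κ :: Γ.map Entry.shift

def Ctx.kinds : Ctx → List Kind
  | [] => []
  | .var _ :: Γ => Ctx.kinds Γ
  | .tvar κ :: Γ => κ :: Ctx.kinds Γ

/-- `Γ.lookup i` is the type of the `i`-th term variable. -/
def Ctx.lookup : Ctx → ℕ → Option Ty
  | [], _ => none
  | .var A :: _, 0 => some A
  | .var _ :: Γ, i + 1 => Ctx.lookup Γ i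
  | .tvar _ :: Γ, i => Ctx.lookup Γ i

/-- The scope that `Γ` provides when `k` type variables are declared to the right of `Γ`. -/
def Ctx.scope (S : Sig) (k : ℕ) (Γ : Ctx) : Scope Kind where
  labels := S.map Prod.fst
  kinds := List.replicate k none ++ (Ctx.kinds Γ).map some

/-- `E : Effect`. -/
inductive RowWf (Ω : Scope Kind) : Row → Prop
  | nil : RowWf Ω .nil
  | var {i : ℕ} : Ω.HasKind i .effect → RowWf Ω (.var i)
  | cons {l : Label} {E : Row} : l ∈ Ω.labels → RowWf Ω E → RowWf Ω (.cons l E)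

/-- `A : Value`. -/
inductive TyWf : Scope Kind → Ty → Prop
  | unit {Ω : Scope Kind} : TyWf Ω .unit
  | var {Ω : Scope Kind} {i : ℕ} : Ω.HasKind i .value → TyWf Ω (.var i)
  | arr {Ω : Scope Kind} {A B : Ty} {E : Row} :
      TyWf Ω A → RowWf Ω E → TyWf Ω B → TyWf Ω (.arr A E B)
  | all {Ω : Scope Kind} {κ : Kind} {A : Ty} : TyWf (Ω.push κ) A → TyWf Ω (.all κ A)

/-- `T : κ`, for a value type or an effect row `T`. -/
inductive ArgKind (Ω : Scope Kind) : TyArg → Kind → Prop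
  | ty {A : Ty} : TyWf Ω A → ArgKind Ω (.ty A) .value
  | row {E : Row} : RowWf Ω E → ArgKind Ω (.row E) .effect

/-- Well-formed label contexts: operations have closed argument and result types. -/
def SigWf (S : Sig) : Prop :=
  ∀ l A B, (l, A, B) ∈ S → TyWf (Ctx.scope S 0 []) A ∧ TyWf (Ctx.scope S 0 []) B

/-- Well-formedness of a context to the right of which `k` type variables are declared. Every
type is checked against the type variables to its left. -/
inductive CtxWf (S : Sig) : ℕ → Ctx → Prop
  | nil {k : ℕ} : CtxWf S k []
  | var {k : ℕ} {Γ : Ctx} {A : Ty} : CtxWf S k Γ → TyWf (Ctx.scope S k Γ) A →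
      CtxWf S k (.var A :: Γ)
  | tvar {k : ℕ} {Γ : Ctx} {κ : Kind} : CtxWf S (k + 1) Γ → CtxWf S k (.tvar κ :: Γ)

mutual

/-- Values. -/
inductive Val : Type
  | unit
  | var (i : ℕ)
  /-- `λ^E x^A. M` -/
  | lam (E : Row) (A : Ty) (M : Comp)
  /-- `Λ α^K. V` -/
  | tlam (κ : Kind) (V : Val)
  /-- `handler {ℓ p r ↦ N}`; in `N`, `r` is variable `0` and `p` is variable `1`. -/
  | handler (l : Label) (N : Comp)

/-- Computations. -/
inductive Comp : Type
  | ret (V : Val)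
  | app (V W : Val)
  | tapp (V : Val) (T : TyArg)
  /-- `do ℓ V` -/
  | perform (l : Label) (V : Val)
  /-- `let x = M in N` -/
  | letin (M N : Comp)
  /-- The runtime construct `handle M with {ℓ p r ↦ N}`. -/
  | handle (M : Comp) (l : Label) (N : Comp)

end

mutual

/-- Derivations of `Γ ⊢ V : A`. They are data: the translation is defined on them. -/
inductive ValTyping (S : Sig) : Ctx → Val → Ty → Type
  | unit {Γ : Ctx} : CtxWf S 0 Γ → ValTyping S Γ .unit .unit
  | var {Γ : Ctx} {i : ℕ} {A : Ty} : CtxWf S 0 Γ → Γ.lookup i = some A →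
      ValTyping S Γ (.var i) A
  | lam {Γ : Ctx} {A B : Ty} {E : Row} {M : Comp} :
      CompTyping S (.var A :: Γ) M B E →
      ValTyping S Γ (.lam E A M) (.arr A E B)
  | tlam {Γ : Ctx} {κ : Kind} {V : Val} {A : Ty} :
      ValTyping S (Γ.bindT κ) V A →
      ValTyping S Γ (.tlam κ V) (.all κ A)
  | handler {Γ : Ctx} {l : Label} {A' B' A : Ty} {E : Row} {N : Comp} :
      (l, A', B') ∈ S →
      CompTyping S (.var (.arr B' E A) :: .var A' :: Γ) N A E →
      ValTyping S Γ (.handler l N) (.arr (.arr .unit (.cons l E) A) E A)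
  | conv {Γ : Ctx} {V : Val} {A B : Ty} :
      ValTyping S Γ V A → TyEquiv A B → TyWf (Γ.scope S 0) B →
      ValTyping S Γ V B

/-- Derivations of `Γ ⊢ M : A | E`. -/
inductive CompTyping (S : Sig) : Ctx → Comp → Ty → Row → Type
  | ret {Γ : Ctx} {V : Val} {A : Ty} {E : Row} :
      ValTyping S Γ V A → RowWf (Γ.scope S 0) E →
      CompTyping S Γ (.ret V) A E
  | letin {Γ : Ctx} {M N : Comp} {A B : Ty} {E : Row} :
      CompTyping S Γ M A E →
      CompTyping S (.var A :: Γ) N B E →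
      CompTyping S Γ (.letin M N) B E
  | app {Γ : Ctx} {V W : Val} {A B : Ty} {E : Row} :
      ValTyping S Γ V (.arr A E B) →
      ValTyping S Γ W A →
      CompTyping S Γ (.app V W) B E
  | tapp {Γ : Ctx} {V : Val} {κ : Kind} {B : Ty} {T : TyArg} {E : Row} :
      ValTyping S Γ V (.all κ B) →
      ArgKind (Γ.scope S 0) T κ → RowWf (Γ.scope S 0) E →
      CompTyping S Γ (.tapp V T) (B.inst T) E
  | perform {Γ : Ctx} {l : Label} {A B : Ty} {V : Val} {E : Row} :
      (l, A, B) ∈ S →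
      ValTyping S Γ V A → RowWf (Γ.scope S 0) E →
      CompTyping S Γ (.perform l V) B (.cons l E)
  | handle {Γ : Ctx} {l : Label} {A' B' A : Ty} {E : Row} {M N : Comp} :
      (l, A', B') ∈ S →
      CompTyping S Γ M A (.cons l E) →
      CompTyping S (.var (.arr B' E A) :: .var A' :: Γ) N A E →
      CompTyping S Γ (.handle M l N) A E
  | conv {Γ : Ctx} {M : Comp} {A B : Ty} {E F : Row} :
      CompTyping S Γ M A E → TyEquiv A B → RowEquiv E F →
      TyWf (Γ.scope S 0) B → RowWf (Γ.scope S 0) F →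
      CompTyping S Γ M B F

end

end Feps

/-! ## The modal effect calculus Met(R_scp) -/

namespace Met

inductive Kind : Type
  | abs
  | any
  | effect

inductive Atom : Type
  | lab (l : Label)
  | evar (i : ℕ)

/-- Extensions `D`: lists of labels and effect variables. -/
abbrev Ext := List Atom

/-- Effect contexts `E`: lists of labels and effect variables. -/
abbrev Eff := List Atom

inductive Modality : Type
  /-- The absolute modality `[E]`. -/
  | abs (E : Eff)
  /-- The extension modality `⟨D⟩`. -/
  | ext (D : Ext)

/-- The identity modality `⟨⟩`. -/
def Modality.one : Modality := .ext []

/-- `μ(F)`. -/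
def Modality.act : Modality → Eff → Eff
  | .abs E, _ => E
  | .ext D, F => D ++ F

/-- `μ ∘ ν`, composed from left to right. -/
def Modality.comp : Modality → Modality → Modality
  | _, .abs E => .abs E
  | .abs E, .ext D => .abs (D ++ E)
  | .ext D₁, .ext D₂ => .ext (D₂ ++ D₁)

/-- Types `A ::= 1 | α | A → B | □_μ A | ∀ α^K. A`. -/
inductive Ty : Type
  | unit
  | var (i : ℕ)
  | arr (A B : Ty)
  | box (μ : Modality) (A : Ty)
  | all (κ : Kind) (A : Ty)

/-- Arguments of type applications: value types and effect contexts. -/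
inductive TyArg : Type
  | ty (A : Ty)
  | eff (E : Eff)

def Atom.rename (ρ : ℕ → ℕ) : Atom → Atom
  | .lab l => .lab l
  | .evar i => .evar (ρ i)

def Eff.rename (ρ : ℕ → ℕ) (E : Eff) : Eff := E.map (Atom.rename ρ)

def Modality.rename (ρ : ℕ → ℕ) : Modality → Modality
  | .abs E => .abs (Eff.rename ρ E)
  | .ext D => .ext (Eff.rename ρ D)

def Ty.rename : (ℕ → ℕ) → Ty → Ty
  | _, .unit => .unit
  | ρ, .var i => .var (ρ i)
  | ρ, .arr A B => .arr (A.rename ρ) (B.rename ρ)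
  | ρ, .box μ A => .box (μ.rename ρ) (A.rename ρ)
  | ρ, .all κ A => .all κ (A.rename (liftRen ρ))

/-- Simultaneous substitutions for type variables: `ty` acts on occurrences as value types,
`eff` on occurrences as effect variables. -/
structure Subst where
  ty : ℕ → Ty
  eff : ℕ → Eff

def Subst.lift (σ : Subst) : Subst where
  ty
    | 0 => .var 0
    | i + 1 => (σ.ty i).rename Nat.succ
  eff
    | 0 => [.evar 0]
    | i + 1 => Eff.rename Nat.succ (σ.eff i)

def Atom.subst (σ : Subst) : Atom → Eff
  | .lab l => [.lab l]
  | .evar i => σ.eff i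

def Eff.subst (σ : Subst) (E : Eff) : Eff := E.flatMap (Atom.subst σ)

def Modality.subst (σ : Subst) : Modality → Modality
  | .abs E => .abs (Eff.subst σ E)
  | .ext D => .ext (Eff.subst σ D)

def Ty.subst : Subst → Ty → Ty
  | _, .unit => .unit
  | σ, .var i => σ.ty i
  | σ, .arr A B => .arr (A.subst σ) (B.subst σ)
  | σ, .box μ A => .box (μ.subst σ) (A.subst σ)
  | σ, .all κ A => .all κ (A.subst σ.lift)

/-- The substitution `[T/α]` for the most recent type variable. Its value at the occurrences
of `α` whose sort differs from that of `T` is arbitrary: well-kinded types have none. -/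
def TyArg.toSubst : TyArg → Subst
  | .ty A =>
    { ty := fun | 0 => A | i + 1 => .var i
      eff := fun | 0 => [] | i + 1 => [.evar i] }
  | .eff E =>
    { ty := fun | 0 => .unit | i + 1 => .var i
      eff := fun | 0 => E | i + 1 => [.evar i] }

/-- `A[T/α]`. -/
def Ty.inst (A : Ty) (T : TyArg) : Ty := A.subst T.toSubst

/-! ### The effect theory of scoped rows -/

/-- `D : Effect` for extensions: labels, possibly repeated, and no effect variable. -/
inductive ExtWf (Ω : Scope Kind) : Ext → Prop
  | nil : ExtWf Ω []
  | cons {l : Label} {D : Ext} : l ∈ Ω.labels → ExtWf Ω D → ExtWf Ω (.lab l :: D)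

/-- `D ≡ D'`: equality modulo reordering of distinct labels. -/
inductive ExtEquiv : Ext → Ext → Prop
  | refl (D : Ext) : ExtEquiv D D
  | trans {D₁ D₂ D₃ : Ext} : ExtEquiv D₁ D₂ → ExtEquiv D₂ D₃ → ExtEquiv D₁ D₃
  | cons (l : Label) {D D' : Ext} : ExtEquiv D D' → ExtEquiv (.lab l :: D) (.lab l :: D')
  | swap {l l' : Label} (D : Ext) : l ≠ l' →
      ExtEquiv (.lab l :: .lab l' :: D) (.lab l' :: .lab l :: D)

/-- `E : Effect` for effect contexts. -/
inductive EffWf (Ω : Scope Kind) : Eff → Prop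
  | nil : EffWf Ω []
  | evar {i : ℕ} : Ω.HasKind i .effect → EffWf Ω [.evar i]
  | append {D : Ext} {E : Eff} : ExtWf Ω D → EffWf Ω E → EffWf Ω (D ++ E)

/-- `E ≡ F` for effect contexts. -/
inductive EffEquiv : Eff → Eff → Prop
  | nil : EffEquiv [] []
  | evar (i : ℕ) : EffEquiv [.evar i] [.evar i]
  | append {D₁ D₂ : Ext} {E₁ E₂ : Eff} : ExtEquiv D₁ D₂ → EffEquiv E₁ E₂ →
      EffEquiv (D₁ ++ E₁) (D₂ ++ E₂)

/-- Subeffecting `E ≤ F`. -/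
def SubEff (Ω : Scope Kind) (E F : Eff) : Prop :=
  ∃ E' : Eff, EffWf Ω (E ++ E') ∧ EffEquiv (E ++ E') F

/-- Modality transformation `μ ⇒ ν @ F`. -/
inductive ModTrans (Ω : Scope Kind) : Modality → Modality → Eff → Prop
  | abs {E F : Eff} {μ : Modality} : SubEff Ω E (μ.act F) → ModTrans Ω (.abs E) μ F
  | extend {D₁ D₂ : Ext} {E : Eff} :
      (∀ F : Eff, SubEff Ω E F → SubEff Ω (D₁ ++ F) (D₂ ++ F)) →
      ModTrans Ω (.ext D₁) (.ext D₂) E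

/-! ### Kinds and type equivalence -/

/-- Well-formed modalities. -/
inductive ModWf (Ω : Scope Kind) : Modality → Prop
  | abs {E : Eff} : EffWf Ω E → ModWf Ω (.abs E)
  | ext {D : Ext} : ExtWf Ω D → ModWf Ω (.ext D)

/-- `A : κ` for value types `A`; here `κ` is `abs` or `any`. -/
inductive TyKind : Scope Kind → Ty → Kind → Prop
  | sub {Ω : Scope Kind} {A : Ty} : TyKind Ω A .abs → TyKind Ω A .any
  | var {Ω : Scope Kind} {i : ℕ} {κ : Kind} : Ω.HasKind i κ → κ ≠ .effect →
      TyKind Ω (.var i) κ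
  | unit {Ω : Scope Kind} : TyKind Ω .unit .abs
  | boxAbs {Ω : Scope Kind} {E : Eff} {A : Ty} :
      ModWf Ω (.abs E) → TyKind Ω A .any → TyKind Ω (.box (.abs E) A) .abs
  | boxExt {Ω : Scope Kind} {D : Ext} {A : Ty} {κ : Kind} :
      ModWf Ω (.ext D) → TyKind Ω A κ → TyKind Ω (.box (.ext D) A) κ
  | arr {Ω : Scope Kind} {A B : Ty} :
      TyKind Ω A .any → TyKind Ω B .any → TyKind Ω (.arr A B) .any
  | all {Ω : Scope Kind} {κ κ' : Kind} {A : Ty} :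
      TyKind (Ω.push κ) A κ' → TyKind Ω (.all κ A) κ'

/-- `T : κ`, for a value type or an effect context `T`. -/
inductive ArgKind (Ω : Scope Kind) : TyArg → Kind → Prop
  | ty {A : Ty} {κ : Kind} : TyKind Ω A κ → ArgKind Ω (.ty A) κ
  | eff {E : Eff} : EffWf Ω E → ArgKind Ω (.eff E) .effect

/-- `A ↠ B` is a well-formed operation signature. -/
def OpWf (Ω : Scope Kind) (A B : Ty) : Prop := TyKind Ω A .abs ∧ TyKind Ω B .abs

inductive ModEquiv : Modality → Modality → Prop
  | abs {E F : Eff} : EffEquiv E F → ModEquiv (.abs E) (.abs F)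
  | ext {D D' : Ext} : ExtEquiv D D' → ModEquiv (.ext D) (.ext D')

/-- Type equivalence `A ≡ B`. -/
inductive TyEquiv : Ty → Ty → Prop
  | var (i : ℕ) : TyEquiv (.var i) (.var i)
  | unit : TyEquiv .unit .unit
  | box {μ ν : Modality} {A B : Ty} : ModEquiv μ ν → TyEquiv A B →
      TyEquiv (.box μ A) (.box ν B)
  | arr {A A' B B' : Ty} : TyEquiv A A' → TyEquiv B B' → TyEquiv (.arr A B) (.arr A' B')
  | all (κ : Kind) {A B : Ty} : TyEquiv A B → TyEquiv (.all κ A) (.all κ B)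

/-! ### Contexts -/

/-- Label contexts; an entry `(ℓ, A, B)` stands for `ℓ : A ↠ B`. -/
abbrev Sig := List (Label × Ty × Ty)

inductive Entry : Type
  /-- `α : K` -/
  | tvar (κ : Kind)
  /-- The lock of `μ_F`. -/
  | lock (μ : Modality) (F : Eff)
  /-- `x :_{μ_F} A` -/
  | var (μ : Modality) (F : Eff) (A : Ty)
  /-- `ℓ : A ↠ B` -/
  | label (l : Label) (A B : Ty)

abbrev Ctx := List Entry

def Entry.shift : Entry → Entry
  | .tvar κ => .tvar κ
  | .lock μ F => .lock (μ.rename Nat.succ) (Eff.rename Nat.succ F)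
  | .var μ F A => .var (μ.rename Nat.succ) (Eff.rename Nat.succ F) (A.rename Nat.succ)
  | .label l A B => .label l (A.rename Nat.succ) (B.rename Nat.succ)

/-- `Γ, α : κ`. -/
def Ctx.bindT (Γ : Ctx) (κ : Kind) : Ctx := .tvar κ :: Γ.map Entry.shift

def Ctx.kinds : Ctx → List Kind
  | [] => []
  | .tvar κ :: Γ => κ :: Ctx.kinds Γ
  | .lock _ _ :: Γ => Ctx.kinds Γ
  | .var _ _ _ :: Γ => Ctx.kinds Γ
  | .label _ _ _ :: Γ => Ctx.kinds Γ

def Ctx.labels : Ctx → List Label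
  | [] => []
  | .tvar _ :: Γ => Ctx.labels Γ
  | .lock _ _ :: Γ => Ctx.labels Γ
  | .var _ _ _ :: Γ => Ctx.labels Γ
  | .label l _ _ :: Γ => l :: Ctx.labels Γ

/-- The number of term variables of a context. -/
def Ctx.numVars : Ctx → ℕ
  | [] => 0
  | .tvar _ :: Γ => Ctx.numVars Γ
  | .lock _ _ :: Γ => Ctx.numVars Γ
  | .var _ _ _ :: Γ => Ctx.numVars Γ + 1
  | .label _ _ _ :: Γ => Ctx.numVars Γ

/-- The composition of the modalities on the locks of a context. -/
def Ctx.locks : Ctx → Modality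
  | [] => .one
  | .tvar _ :: Γ => Ctx.locks Γ
  | .lock μ _ :: Γ => (Ctx.locks Γ).comp μ
  | .var _ _ _ :: Γ => Ctx.locks Γ
  | .label _ _ _ :: Γ => Ctx.locks Γ

/-- The scope that `Γ` provides when `k` type variables are declared to the right of `Γ`. -/
def Ctx.scope (S : Sig) (k : ℕ) (Γ : Ctx) : Scope Kind where
  labels := Ctx.labels Γ ++ S.map Prod.fst
  kinds := List.replicate k none ++ (Ctx.kinds Γ).map some

/-- `S, Γ ∋ ℓ : A ↠ B`. -/
def HasOp (S : Sig) (Γ : Ctx) (l : Label) (A B : Ty) : Prop :=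
  (l, A, B) ∈ S ∨ Entry.label l A B ∈ Γ

def SigWf (S : Sig) : Prop :=
  ∀ l A B, (l, A, B) ∈ S → OpWf (Ctx.scope S 0 []) A B

/-- `Γ @ E`, for a context `Γ` to the right of which `k` type variables are declared. Every
type is checked against what is declared to its left; the effect contexts that index the
entries are only checked to fit together, up to equivalence. -/
inductive CtxWf (S : Sig) : ℕ → Ctx → Eff → Prop
  | nil {k : ℕ} {E : Eff} : CtxWf S k [] E
  | var {k : ℕ} {Γ : Ctx} {μ : Modality} {F : Eff} {A : Ty} {κ : Kind} :
      CtxWf S k Γ F → TyKind (Ctx.scope S k Γ) A κ → CtxWf S k (.var μ F A :: Γ) F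
  | lock {k : ℕ} {Γ : Ctx} {μ : Modality} {F : Eff} :
      CtxWf S k Γ F → CtxWf S k (.lock μ F :: Γ) (μ.act F)
  | tvar {k : ℕ} {Γ : Ctx} {κ : Kind} {E : Eff} :
      CtxWf S (k + 1) Γ E → CtxWf S k (.tvar κ :: Γ) E
  | label {k : ℕ} {Γ : Ctx} {l : Label} {A B : Ty} {E : Eff} :
      CtxWf S k Γ E → OpWf (Ctx.scope S k Γ) A B →
      l ∉ Ctx.labels Γ → l ∉ S.map Prod.fst →
      CtxWf S k (.label l A B :: Γ) E
  | conv {k : ℕ} {Γ : Ctx} {E F : Eff} :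
      CtxWf S k Γ E → EffEquiv E F → CtxWf S k Γ F

/-- The two equations up to which contexts are identified. -/
inductive CtxEq : Ctx → Ctx → Prop
  | unit (Γ Γ' : Ctx) (F : Eff) : CtxEq (Γ' ++ .lock .one F :: Γ) (Γ' ++ Γ)
  | comp (Γ Γ' : Ctx) (μ ν : Modality) (F F' : Eff) :
      CtxEq (Γ' ++ .lock ν F' :: .lock μ F :: Γ) (Γ' ++ .lock (μ.comp ν) F :: Γ)

/-! ### Terms -/

inductive Term : Type
  | unit
  | var (i : ℕ)
  /-- `λ x^A. M` -/
  | lam (A : Ty) (M : Term)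
  | app (M N : Term)
  /-- `Λ α^K. V` -/
  | tlam (κ : Kind) (V : Term)
  | tapp (M : Term) (T : TyArg)
  /-- `mod_μ V` -/
  | mod (μ : Modality) (V : Term)
  /-- `let_ν mod_μ x = V in M` -/
  | letmod (ν μ : Modality) (V M : Term)
  /-- `do ℓ M` -/
  | perform (l : Label) (M : Term)
  /-- `local ℓ : A ↠ B in M` -/
  | localEff (l : Label) (A B : Ty) (M : Term)
  /-- `handle^μ M with {return x ↦ N, ℓ p r ↦ N'}`; in `N'`, `r` is variable `0` and `p` is
  variable `1`. -/
  | handle (μ : Modality) (M N : Term) (l : Label) (N' : Term)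

/-- Renaming of term variables. -/
def Term.rename : (ℕ → ℕ) → Term → Term
  | _, .unit => .unit
  | ρ, .var i => .var (ρ i)
  | ρ, .lam A M => .lam A (M.rename (liftRen ρ))
  | ρ, .app M N => .app (M.rename ρ) (N.rename ρ)
  | ρ, .tlam κ V => .tlam κ (V.rename ρ)
  | ρ, .tapp M T => .tapp (M.rename ρ) T
  | ρ, .mod μ V => .mod μ (V.rename ρ)
  | ρ, .letmod ν μ V M => .letmod ν μ (V.rename ρ) (M.rename (liftRen ρ))
  | ρ, .perform l M => .perform l (M.rename ρ)
  | ρ, .localEff l A B M => .localEff l A B (M.rename ρ)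
  | ρ, .handle μ M N l N' =>
      .handle μ (M.rename ρ) (N.rename (liftRen ρ)) l (N'.rename (liftRen (liftRen ρ)))

/-- `let x = M in N`, sugar for `(λ x^A. N) M`. -/
def Term.letin (A : Ty) (M N : Term) : Term := .app (.lam A N) M

/-- The values among the terms. -/
inductive IsValue : Term → Prop
  | unit : IsValue .unit
  | var (i : ℕ) : IsValue (.var i)
  | lam (A : Ty) (M : Term) : IsValue (.lam A M)
  | tlam (κ : Kind) {V : Term} : IsValue V → IsValue (.tlam κ V)
  | mod (μ : Modality) {V : Term} : IsValue V → IsValue (.mod μ V)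
  | tapp {V : Term} (T : TyArg) : IsValue V → IsValue (.tapp V T)
  | letmod (ν μ : Modality) {V W : Term} : IsValue V → IsValue W →
      IsValue (.letmod ν μ V W)

/-! ### Typing -/

/-- `(μ, A) ⇒ ν @ F`. -/
def VarTrans (Ω : Scope Kind) (μ : Modality) (A : Ty) (ν : Modality) (F : Eff) : Prop :=
  TyKind Ω A .abs ∨ ModTrans Ω μ ν F

/-- What every judgement `Γ ⊢ M : A @ E` presupposes. -/
structure JudgWf (S : Sig) (Γ : Ctx) (A : Ty) (E : Eff) : Prop where
  sig : SigWf S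
  ctx : CtxWf S 0 Γ E
  eff : EffWf (Γ.scope S 0) E
  ty : TyKind (Γ.scope S 0) A .any

/-- The typing judgement `Γ ⊢ M : A @ E`. A binding without a modality annotation is tagged
with the identity modality at the ambient effect context. The rules `conv` and `ctxEq` express
that types and effect contexts are taken up to equivalence, and contexts up to `CtxEq`. -/
inductive Typing (S : Sig) : Ctx → Term → Ty → Eff → Prop
  | var {Γ Γ' : Ctx} {μ : Modality} {F E : Eff} {A : Ty} :
      JudgWf S (Γ' ++ .var μ F A :: Γ) A E →
      VarTrans (Ctx.scope S 0 (Γ' ++ .var μ F A :: Γ)) μ A (Ctx.locks Γ') F →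
      Typing S (Γ' ++ .var μ F A :: Γ) (.var (Ctx.numVars Γ')) A E
  | mod {Γ : Ctx} {μ : Modality} {V : Term} {A : Ty} {F : Eff} :
      JudgWf S Γ (.box μ A) F →
      IsValue V →
      Typing S (.lock μ F :: Γ) V A (μ.act F) →
      Typing S Γ (.mod μ V) (.box μ A) F
  | letmod {Γ : Ctx} {ν μ : Modality} {V M : Term} {A B : Ty} {F : Eff} :
      JudgWf S Γ B F →
      IsValue V →
      Typing S (.lock ν F :: Γ) V (.box μ A) (ν.act F) →
      Typing S (.var (ν.comp μ) F A :: Γ) M B F →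
      Typing S Γ (.letmod ν μ V M) B F
  | lam {Γ : Ctx} {A B : Ty} {M : Term} {E : Eff} :
      JudgWf S Γ (.arr A B) E →
      Typing S (.var .one E A :: Γ) M B E →
      Typing S Γ (.lam A M) (.arr A B) E
  | app {Γ : Ctx} {A B : Ty} {M N : Term} {E : Eff} :
      JudgWf S Γ B E →
      Typing S Γ M (.arr A B) E →
      Typing S Γ N A E →
      Typing S Γ (.app M N) B E
  | tlam {Γ : Ctx} {κ : Kind} {V : Term} {A : Ty} {E : Eff} :
      JudgWf S Γ (.all κ A) E →
      IsValue V →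
      Typing S (Γ.bindT κ) V A (Eff.rename Nat.succ E) →
      Typing S Γ (.tlam κ V) (.all κ A) E
  | tapp {Γ : Ctx} {κ : Kind} {M : Term} {A : Ty} {T : TyArg} {E : Eff} :
      JudgWf S Γ (A.inst T) E →
      Typing S Γ M (.all κ A) E →
      ArgKind (Γ.scope S 0) T κ →
      Typing S Γ (.tapp M T) (A.inst T) E
  | unit {Γ : Ctx} {E : Eff} :
      JudgWf S Γ .unit E →
      Typing S Γ .unit .unit E
  | perform {Γ : Ctx} {l : Label} {A B : Ty} {N : Term} {E : Eff} :
      JudgWf S Γ B (.lab l :: E) →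
      HasOp S Γ l A B →
      Typing S Γ N A (.lab l :: E) →
      Typing S Γ (.perform l N) B (.lab l :: E)
  | localEff {Γ : Ctx} {l : Label} {A B A' : Ty} {M : Term} {E : Eff} :
      JudgWf S Γ A' E →
      Typing S (.label l A B :: Γ) M A' E →
      Typing S Γ (.localEff l A B M) A' E
  | handle {Γ : Ctx} {μ : Modality} {l : Label} {A A' B B' : Ty} {M N N' : Term} {E F : Eff} :
      JudgWf S Γ B F →
      μ.act F = E →
      ModTrans (Γ.scope S 0) μ .one F →
      ModTrans (Γ.scope S 0) μ (μ.comp μ) F →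
      Typing S (.lock (.ext [.lab l]) E :: .lock μ F :: Γ) M A (.lab l :: E) →
      HasOp S Γ l A' B' →
      Typing S (.var .one E (.box (μ.comp (.ext [.lab l])) A) :: .lock μ F :: Γ) N B E →
      Typing S (.var .one E (.box μ (.arr B' B)) :: .var .one E A' :: .lock μ F :: Γ) N' B E →
      Typing S Γ (.handle μ M N l N') B F
  | conv {Γ : Ctx} {M : Term} {A B : Ty} {E F : Eff} :
      JudgWf S Γ B F →
      Typing S Γ M A E → TyEquiv A B → EffEquiv E F →
      Typing S Γ M B F
  | ctxEq {Γ Γ' : Ctx} {M : Term} {A : Ty} {E : Eff} :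
      JudgWf S Γ' A E →
      Typing S Γ M A E → CtxEq Γ Γ' ∨ CtxEq Γ' Γ →
      Typing S Γ' M A E

end Met

/-! ## The translation -/

namespace Transl

def kind : Feps.Kind → Met.Kind
  | .effect => .effect
  | .value => .abs

def row : Feps.Row → Met.Eff
  | .nil => []
  | .var i => [.evar i]
  | .cons l E => .lab l :: row E

def ty : Feps.Ty → Met.Ty
  | .unit => .unit
  | .var i => .var i
  | .arr A E B => .box (.abs (row E)) (.arr (ty A) (ty B))
  | .all κ A => .all (kind κ) (ty A)

def arg : Feps.TyArg → Met.TyArg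
  | .ty A => .ty (ty A)
  | .row E => .eff (row E)

def sig (S : Feps.Sig) : Met.Sig := S.map fun e => (e.1, ty e.2.1, ty e.2.2)

/-- The translation of contexts. Term variables are tagged with the identity modality, at the
effect context `F` of the judgement. -/
def ctx (F : Met.Eff) (Γ : Feps.Ctx) : Met.Ctx :=
  Γ.map fun
    | .var A => .var .one F (ty A)
    | .tvar κ => .tvar (kind κ)

/-- The return clause `x ↦ let mod_[ℓ, E] x' = x in x'`. -/
def retClause (l : Label) (E : Feps.Row) : Met.Term :=
  .letmod .one (.abs (row (.cons l E))) (.var 0) (.var 0)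

mutual

/-- The translation of typed values. -/
def val {S : Feps.Sig} {Γ : Feps.Ctx} {V : Feps.Val} {A : Feps.Ty} :
    Feps.ValTyping S Γ V A → Met.Term
  | .unit _ => .unit
  | .var (i := i) _ _ => .var i
  | .lam (A := A) (E := E) d => .mod (.abs (row E)) (.lam (ty A) (comp d))
  | .tlam (κ := κ) d => .tlam (kind κ) (val d)
  | .handler (l := l) (A := A) (E := E) _ d =>
      .mod (.abs (row E))
        (.lam (ty (.arr .unit (.cons l E) A))
          (.handle (.abs (row E))
            (.letmod .one (.abs (row (.cons l E))) (.var 0) (.app (.var 0) .unit))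
            (retClause l E)
            l ((comp d).rename (liftRen (liftRen Nat.succ)))))
  | .conv d _ _ => val d

/-- The translation of typed computations. -/
def comp {S : Feps.Sig} {Γ : Feps.Ctx} {M : Feps.Comp} {A : Feps.Ty} {E : Feps.Row} :
    Feps.CompTyping S Γ M A E → Met.Term
  | .ret d _ => val d
  | .letin (A := A) d e => .letin (ty A) (comp d) (comp e)
  | .app (E := E) d e =>
      .letmod .one (.abs (row E)) (val d) (.app (.var 0) ((val e).rename Nat.succ))
  | .tapp (T := T) d _ _ => .tapp (val d) (arg T)
  | .perform (l := l) _ d _ => .perform l (val d)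
  | .handle (l := l) (E := E) _ d e =>
      .handle (.abs (row E)) (comp d) (retClause l E) l (comp e)
  | .conv d _ _ _ _ => comp d

end

end Transl

theorem liftRen_id : liftRen id = id := by
  funext i; cases i <;> rfl

theorem liftRen_comp (ρ ρ' : ℕ → ℕ) :
    (fun i => liftRen ρ' (liftRen ρ i)) = liftRen (fun i => ρ' (ρ i)) := by
  funext i; cases i <;> rfl

/-- `ρ` sends the variables of `Ω` to variables of `Ω'`, translating kinds along `f`. -/
structure Scope.Maps {K K' : Type} (f : K → K') (ρ : ℕ → ℕ) (Ω : Scope K) (Ω' : Scope K') :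
    Prop where
  labels : Ω.labels ⊆ Ω'.labels
  kinds : ∀ i κ, Ω.HasKind i κ → Ω'.HasKind (ρ i) (f κ)

theorem Scope.Maps.push {K K' : Type} {f : K → K'} {ρ : ℕ → ℕ} {Ω : Scope K} {Ω' : Scope K'}
    (h : Scope.Maps f ρ Ω Ω') (κ : K) :
    Scope.Maps f (liftRen ρ) (Ω.push κ) (Ω'.push (f κ)) where
  labels := h.labels
  kinds i κ' hi := by
    cases i with
    | zero =>
      simp only [Scope.HasKind, Scope.push, List.getElem?_cons_zero, Option.some.injEq] at hi
      simp [Scope.HasKind, Scope.push, liftRen, hi]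
    | succ i =>
      have := h.kinds i κ' (by simpa [Scope.HasKind, Scope.push] using hi)
      simpa [Scope.HasKind, Scope.push, liftRen] using this

/-! ## System F^ε: regularity -/

namespace Feps

theorem RowWf.rename {Ω Ω' : Scope Kind} {ρ : ℕ → ℕ} {E : Row} (h : RowWf Ω E)
    (hρ : Scope.Maps id ρ Ω Ω') : RowWf Ω' (E.rename ρ) := by
  induction h with
  | nil => exact .nil
  | var hi => exact .var (hρ.kinds _ _ hi)
  | cons hl _ ih => exact .cons (hρ.labels hl) ih

theorem TyWf.rename {Ω Ω' : Scope Kind} {ρ : ℕ → ℕ} {A : Ty} (h : TyWf Ω A)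
    (hρ : Scope.Maps id ρ Ω Ω') : TyWf Ω' (A.rename ρ) := by
  induction h generalizing Ω' ρ with
  | unit => exact .unit
  | var hi => exact .var (hρ.kinds _ _ hi)
  | arr _ hE _ ihA ihB => exact .arr (ihA hρ) (hE.rename hρ) (ihB hρ)
  | all _ ih => exact .all (ih (hρ.push _))

theorem Row.rename_id (E : Row) : E.rename id = E := by
  induction E <;> simp_all [Row.rename]

theorem Ty.rename_id (A : Ty) : A.rename id = A := by
  induction A <;> simp_all [Ty.rename, Row.rename_id, liftRen_id]

theorem TyWf.weaken {Ω Ω' : Scope Kind} {A : Ty} (h : TyWf Ω A)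
    (hρ : Scope.Maps id id Ω Ω') : TyWf Ω' A := by
  simpa [Ty.rename_id] using h.rename hρ

theorem RowWf.of_rename {Ω Ω' : Scope Kind} {ρ : ℕ → ℕ} {E : Row} (h : RowWf Ω' (E.rename ρ))
    (hl : Ω'.labels ⊆ Ω.labels) (hk : ∀ i κ, Ω'.HasKind (ρ i) κ → Ω.HasKind i κ) :
    RowWf Ω E := by
  induction E with
  | nil => exact .nil
  | var i => cases h with | var hi => exact .var (hk _ _ hi)
  | cons l E ih => cases h with | cons h₁ h₂ => exact .cons (hl h₁) (ih h₂)

theorem TyWf.of_rename {Ω Ω' : Scope Kind} {ρ : ℕ → ℕ} {A : Ty} (h : TyWf Ω' (A.rename ρ))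
    (hl : Ω'.labels ⊆ Ω.labels) (hk : ∀ i κ, Ω'.HasKind (ρ i) κ → Ω.HasKind i κ) :
    TyWf Ω A := by
  induction A generalizing Ω Ω' ρ with
  | unit => exact .unit
  | var i => cases h with | var hi => exact .var (hk _ _ hi)
  | arr A E B ihA ihB =>
    cases h with
    | arr h₁ h₂ h₃ => exact .arr (ihA h₁ hl hk) (h₂.of_rename hl hk) (ihB h₃ hl hk)
  | all κ A ih =>
    cases h with
    | all h =>
      refine .all (ih h hl fun i κ' hi => ?_)
      cases i with
      | zero => simpa [Scope.HasKind, Scope.push, liftRen] using hi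
      | succ i =>
        have := hk i κ' (by simpa [Scope.HasKind, Scope.push, liftRen] using hi)
        simpa [Scope.HasKind, Scope.push] using this

/-- Well-kinded substitutions. -/
structure Subst.Maps (σ : Subst) (Ω Ω' : Scope Kind) : Prop where
  labels : Ω.labels ⊆ Ω'.labels
  ty : ∀ i, Ω.HasKind i .value → TyWf Ω' (σ.ty i)
  row : ∀ i, Ω.HasKind i .effect → RowWf Ω' (σ.row i)

theorem maps_succ_push (Ω : Scope Kind) (κ : Kind) : Scope.Maps id Nat.succ Ω (Ω.push κ) where
  labels := fun _ h => h
  kinds i κ' h := by simpa [Scope.HasKind, Scope.push] using h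

theorem Subst.Maps.lift {σ : Subst} {Ω Ω' : Scope Kind} (h : σ.Maps Ω Ω') (κ : Kind) :
    σ.lift.Maps (Ω.push κ) (Ω'.push κ) where
  labels := h.labels
  ty i hi := by
    cases i with
    | zero => exact .var (by simpa [Scope.HasKind, Scope.push] using hi)
    | succ i =>
      exact (h.ty i (by simpa [Scope.HasKind, Scope.push] using hi)).rename (maps_succ_push _ _)
  row i hi := by
    cases i with
    | zero => exact .var (by simpa [Scope.HasKind, Scope.push] using hi)
    | succ i =>
      exact (h.row i (by simpa [Scope.HasKind, Scope.push] using hi)).rename (maps_succ_push _ _)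

theorem RowWf.subst {Ω Ω' : Scope Kind} {σ : Subst} {E : Row} (h : RowWf Ω E)
    (hσ : σ.Maps Ω Ω') : RowWf Ω' (E.subst σ) := by
  induction h with
  | nil => exact .nil
  | var hi => exact hσ.row _ hi
  | cons hl _ ih => exact .cons (hσ.labels hl) ih

theorem TyWf.subst {Ω Ω' : Scope Kind} {σ : Subst} {A : Ty} (h : TyWf Ω A)
    (hσ : σ.Maps Ω Ω') : TyWf Ω' (A.subst σ) := by
  induction h generalizing Ω' σ with
  | unit => exact .unit
  | var hi => exact hσ.ty _ hi
  | arr _ hE _ ihA ihB => exact .arr (ihA hσ) (hE.subst hσ) (ihB hσ)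
  | all _ ih => exact .all (ih (hσ.lift _))

theorem ArgKind.maps {Ω : Scope Kind} {T : TyArg} {κ : Kind} (h : ArgKind Ω T κ) :
    T.toSubst.Maps (Ω.push κ) Ω := by
  cases h with
  | ty hA =>
    refine ⟨fun _ h => h, ?_, ?_⟩
    · rintro (_ | i) hi
      · exact hA
      · exact .var (by simpa [Scope.HasKind, Scope.push] using hi)
    · rintro (_ | i) hi
      · simp [Scope.HasKind, Scope.push] at hi
      · exact .var (by simpa [Scope.HasKind, Scope.push] using hi)
  | row hE =>
    refine ⟨fun _ h => h, ?_, ?_⟩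
    · rintro (_ | i) hi
      · simp [Scope.HasKind, Scope.push] at hi
      · exact .var (by simpa [Scope.HasKind, Scope.push] using hi)
    · rintro (_ | i) hi
      · exact hE
      · exact .var (by simpa [Scope.HasKind, Scope.push] using hi)

theorem Ctx.kinds_map_shift (Γ : Ctx) : Ctx.kinds (Γ.map Entry.shift) = Ctx.kinds Γ := by
  induction Γ with
  | nil => rfl
  | cons e Γ ih => cases e <;> simp_all [Ctx.kinds, Entry.shift]

theorem Ctx.scope_bindT (S : Sig) (Γ : Ctx) (κ : Kind) :
    (Γ.bindT κ).scope S 0 = (Γ.scope S 0).push κ := by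
  simp [Ctx.scope, Ctx.bindT, Ctx.kinds, Scope.push, Ctx.kinds_map_shift]

theorem CtxWf.of_shift {S : Sig} {k : ℕ} {Γ : Ctx} (h : CtxWf S (k + 1) (Γ.map Entry.shift)) :
    CtxWf S k Γ := by
  induction Γ generalizing k with
  | nil => exact .nil
  | cons e Γ ih =>
    cases e with
    | var A =>
      cases h with
      | var h₁ h₂ =>
        refine .var (ih h₁) (h₂.of_rename (fun _ h => h) fun i κ hi => ?_)
        simpa [Scope.HasKind, Ctx.scope, List.replicate_succ, Ctx.kinds_map_shift] using hi
    | tvar κ => cases h with | tvar h => exact .tvar (ih h)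

theorem maps_scope_tvar (S : Sig) (Γ : Ctx) (k : ℕ) (κ : Kind) :
    Scope.Maps id id (Ctx.scope S (k + 1) Γ) (Ctx.scope S k (.tvar κ :: Γ)) where
  labels := fun _ h => h
  kinds i κ' h := by
    simp only [Scope.HasKind, Ctx.scope, Ctx.kinds, List.replicate_succ', List.append_assoc,
      List.map_cons, id] at h ⊢
    rcases lt_trichotomy i k with hi | rfl | hi
    · rw [List.getElem?_append_left (by simpa using hi)] at h ⊢
      exact h
    · simp at h
    · rw [List.getElem?_append_right (by simpa using hi.le)] at h ⊢
      obtain ⟨j, rfl⟩ := Nat.exists_eq_add_of_lt hi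
      have e : k + j + 1 - k = j + 1 := by omega
      simpa [e] using h

theorem maps_scope_nil (S : Sig) (Γ : Ctx) :
    Scope.Maps id id (Ctx.scope S 0 []) (Ctx.scope S 0 Γ) where
  labels := fun _ h => h
  kinds i κ h := by simp [Scope.HasKind, Ctx.scope, Ctx.kinds] at h

theorem CtxWf.lookup {S : Sig} {k : ℕ} {Γ : Ctx} (h : CtxWf S k Γ) {i : ℕ} {A : Ty}
    (hi : Γ.lookup i = some A) : TyWf (Ctx.scope S k Γ) A := by
  induction h generalizing i with
  | nil => simp [Ctx.lookup] at hi
  | var _ hA ih =>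
    cases i with
    | zero => simp only [Ctx.lookup, Option.some.injEq] at hi; exact hi ▸ hA
    | succ i => exact ih hi
  | tvar _ ih => exact (ih (by simpa [Ctx.lookup] using hi)).weaken (maps_scope_tvar _ _ _ _)

mutual

theorem ValTyping.regular {S : Sig} (hS : SigWf S) {Γ : Ctx} {V : Val} {A : Ty} :
    ValTyping S Γ V A → CtxWf S 0 Γ ∧ TyWf (Γ.scope S 0) A
  | .unit h => ⟨h, .unit⟩
  | .var h hi => ⟨h, h.lookup hi⟩
  | .lam d => by
    obtain ⟨hΓ, hB, hE⟩ := CompTyping.regular hS d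
    cases hΓ with | var hΓ hA => exact ⟨hΓ, .arr hA hE hB⟩
  | .tlam d => by
    obtain ⟨hΓ, hA⟩ := ValTyping.regular hS d
    cases hΓ with
    | tvar hΓ => exact ⟨hΓ.of_shift, .all (by simpa [Ctx.scope_bindT] using hA)⟩
  | .handler hl d => by
    obtain ⟨hΓ, hA, hE⟩ := CompTyping.regular hS d
    cases hΓ with
    | var hΓ _ =>
      cases hΓ with
      | var hΓ _ =>
        exact ⟨hΓ, .arr (.arr .unit (.cons (List.mem_map_of_mem hl) hE) hA) hE hA⟩
  | .conv d _ hB => ⟨(ValTyping.regular hS d).1, hB⟩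

theorem CompTyping.regular {S : Sig} (hS : SigWf S) {Γ : Ctx} {M : Comp} {A : Ty} {E : Row} :
    CompTyping S Γ M A E → CtxWf S 0 Γ ∧ TyWf (Γ.scope S 0) A ∧ RowWf (Γ.scope S 0) E
  | .ret d hE =>
    have h := ValTyping.regular hS d
    ⟨h.1, h.2, hE⟩
  | .letin d e =>
    have h := CompTyping.regular hS d
    have h' := CompTyping.regular hS e
    ⟨h.1, h'.2.1, h.2.2⟩
  | .app d _ => by
    obtain ⟨hΓ, hA⟩ := ValTyping.regular hS d
    cases hA with | arr _ hE hB => exact ⟨hΓ, hB, hE⟩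
  | .tapp d hT hE => by
    obtain ⟨hΓ, hA⟩ := ValTyping.regular hS d
    cases hA with | all hA => exact ⟨hΓ, hA.subst hT.maps, hE⟩
  | .perform hl d hE =>
    ⟨(ValTyping.regular hS d).1, (hS _ _ _ hl).2.weaken (maps_scope_nil _ _),
      .cons (List.mem_map_of_mem hl) hE⟩
  | .handle _ d e => by
    obtain ⟨hΓ, hA, hE⟩ := CompTyping.regular hS d
    cases hE with | cons _ hE => exact ⟨hΓ, hA, hE⟩
  | .conv d _ _ hB hF => ⟨(CompTyping.regular hS d).1, hB, hF⟩

end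

end Feps

/-! ## Met: renaming and structural lemmas -/

namespace Met

theorem Term.rename_id (M : Term) : M.rename id = M := by
  induction M <;> simp_all [Term.rename, liftRen_id]

theorem Term.rename_rename (M : Term) (ρ ρ' : ℕ → ℕ) :
    (M.rename ρ).rename ρ' = M.rename (fun i => ρ' (ρ i)) := by
  induction M generalizing ρ ρ' <;> simp_all [Term.rename, liftRen_comp]

theorem IsValue.rename {V : Term} (h : IsValue V) (ρ : ℕ → ℕ) : IsValue (V.rename ρ) := by
  induction h generalizing ρ with
  | unit => exact .unit
  | var i => exact .var _
  | lam A M => exact .lam _ _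
  | tlam κ _ ih => exact .tlam _ (ih ρ)
  | mod μ _ ih => exact .mod _ (ih ρ)
  | tapp T _ ih => exact .tapp _ (ih ρ)
  | letmod ν μ _ _ ih₁ ih₂ => exact .letmod _ _ (ih₁ ρ) (ih₂ _)

theorem ExtEquiv.symm {D D' : Ext} (h : ExtEquiv D D') : ExtEquiv D' D := by
  induction h with
  | refl D => exact .refl D
  | trans _ _ ih₁ ih₂ => exact .trans ih₂ ih₁
  | cons l _ ih => exact .cons l ih
  | swap D hl => exact .swap D hl.symm

theorem EffEquiv.symm {E F : Eff} (h : EffEquiv E F) : EffEquiv F E := by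
  induction h with
  | nil => exact .nil
  | evar i => exact .evar i
  | append hD _ ih => exact .append hD.symm ih

theorem EffWf.equiv_refl {Ω : Scope Kind} {E : Eff} (h : EffWf Ω E) : EffEquiv E E := by
  induction h with
  | nil => exact .nil
  | evar _ => exact .evar _
  | append _ _ ih => exact .append (.refl _) ih

theorem EffWf.subEff_refl {Ω : Scope Kind} {E : Eff} (h : EffWf Ω E) : SubEff Ω E E :=
  ⟨[], by simpa using h, by simpa using h.equiv_refl⟩

theorem EffWf.cons {Ω : Scope Kind} {l : Label} {E : Eff} (hl : l ∈ Ω.labels)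
    (h : EffWf Ω E) : EffWf Ω (.lab l :: E) :=
  .append (.cons hl .nil) h

theorem ExtWf.rename {Ω Ω' : Scope Kind} {ρ : ℕ → ℕ} {D : Ext} (h : ExtWf Ω D)
    (hρ : Scope.Maps id ρ Ω Ω') : ExtWf Ω' (Eff.rename ρ D) := by
  induction h with
  | nil => exact .nil
  | cons hl _ ih => exact .cons (hρ.labels hl) ih

theorem EffWf.rename {Ω Ω' : Scope Kind} {ρ : ℕ → ℕ} {E : Eff} (h : EffWf Ω E)
    (hρ : Scope.Maps id ρ Ω Ω') : EffWf Ω' (Eff.rename ρ E) := by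
  induction h with
  | nil => exact .nil
  | evar hi => exact .evar (hρ.kinds _ _ hi)
  | append hD _ ih =>
    rw [Eff.rename, List.map_append]
    exact .append (hD.rename hρ) ih

theorem ModWf.rename {Ω Ω' : Scope Kind} {ρ : ℕ → ℕ} {μ : Modality} (h : ModWf Ω μ)
    (hρ : Scope.Maps id ρ Ω Ω') : ModWf Ω' (μ.rename ρ) := by
  cases h with
  | abs h => exact .abs (h.rename hρ)
  | ext h => exact .ext (h.rename hρ)

theorem TyKind.rename {Ω Ω' : Scope Kind} {ρ : ℕ → ℕ} {A : Ty} {κ : Kind} (h : TyKind Ω A κ)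
    (hρ : Scope.Maps id ρ Ω Ω') : TyKind Ω' (A.rename ρ) κ := by
  induction h generalizing Ω' ρ with
  | sub _ ih => exact .sub (ih hρ)
  | var hi hκ => exact .var (hρ.kinds _ _ hi) hκ
  | unit => exact .unit
  | boxAbs hμ _ ih => exact .boxAbs (hμ.rename hρ) (ih hρ)
  | boxExt hμ _ ih => exact .boxExt (hμ.rename hρ) (ih hρ)
  | arr _ _ ih₁ ih₂ => exact .arr (ih₁ hρ) (ih₂ hρ)
  | all _ ih => exact .all (ih (hρ.push _))

theorem Eff.rename_append (ρ : ℕ → ℕ) (E F : Eff) :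
    Eff.rename ρ (E ++ F) = Eff.rename ρ E ++ Eff.rename ρ F :=
  List.map_append

theorem Modality.rename_act (ρ : ℕ → ℕ) (μ : Modality) (F : Eff) :
    Eff.rename ρ (μ.act F) = (μ.rename ρ).act (Eff.rename ρ F) := by
  cases μ with
  | abs E => rfl
  | ext D => exact Eff.rename_append ρ D F

theorem ExtEquiv.rename {D D' : Ext} (h : ExtEquiv D D') (ρ : ℕ → ℕ) :
    ExtEquiv (Eff.rename ρ D) (Eff.rename ρ D') := by
  induction h with
  | refl D => exact .refl _
  | trans _ _ ih₁ ih₂ => exact .trans ih₁ ih₂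
  | cons l _ ih => exact .cons l ih
  | swap D hl => exact .swap _ hl

theorem EffEquiv.rename {E F : Eff} (h : EffEquiv E F) (ρ : ℕ → ℕ) :
    EffEquiv (Eff.rename ρ E) (Eff.rename ρ F) := by
  induction h with
  | nil => exact .nil
  | evar i => exact .evar _
  | append hD _ ih =>
    rw [Eff.rename_append, Eff.rename_append]
    exact .append (hD.rename ρ) ih

theorem Ctx.kinds_map_shift (Γ : Ctx) : Ctx.kinds (Γ.map Entry.shift) = Ctx.kinds Γ := by
  induction Γ with
  | nil => rfl
  | cons e Γ ih => cases e <;> simp_all [Ctx.kinds, Entry.shift]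

theorem Ctx.labels_map_shift (Γ : Ctx) : Ctx.labels (Γ.map Entry.shift) = Ctx.labels Γ := by
  induction Γ with
  | nil => rfl
  | cons e Γ ih => cases e <;> simp_all [Ctx.labels, Entry.shift]

theorem Ctx.numVars_map_shift (Γ : Ctx) : Ctx.numVars (Γ.map Entry.shift) = Ctx.numVars Γ := by
  induction Γ with
  | nil => rfl
  | cons e Γ ih => cases e <;> simp_all [Ctx.numVars, Entry.shift]

theorem Ctx.maps_shift (S : Sig) (k : ℕ) (Γ : Ctx) :
    Scope.Maps id Nat.succ (Ctx.scope S k Γ) (Ctx.scope S (k + 1) (Γ.map Entry.shift)) where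
  labels := by simp [Ctx.scope, Ctx.labels_map_shift]
  kinds i κ h := by
    simpa [Scope.HasKind, Ctx.scope, List.replicate_succ, Ctx.kinds_map_shift] using h

theorem Ctx.maps_bindT (S : Sig) (Γ : Ctx) (κ : Kind) :
    Scope.Maps id Nat.succ (Ctx.scope S 0 Γ) (Ctx.scope S 0 (Γ.bindT κ)) where
  labels := by simp [Ctx.scope, Ctx.bindT, Ctx.labels, Ctx.labels_map_shift]
  kinds i κ h := by
    simpa [Scope.HasKind, Ctx.scope, Ctx.bindT, Ctx.kinds, Ctx.kinds_map_shift] using h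

theorem CtxWf.shift {S : Sig} {k : ℕ} {Γ : Ctx} {E : Eff} (h : CtxWf S k Γ E) :
    CtxWf S (k + 1) (Γ.map Entry.shift) (Eff.rename Nat.succ E) := by
  induction h with
  | nil => exact .nil
  | var _ hA ih => exact .var ih (hA.rename (Ctx.maps_shift _ _ _))
  | lock _ ih => rw [Modality.rename_act]; exact .lock ih
  | tvar _ ih => exact .tvar ih
  | label _ hAB hl hl' ih =>
    exact .label ih ⟨hAB.1.rename (Ctx.maps_shift _ _ _), hAB.2.rename (Ctx.maps_shift _ _ _)⟩
      (by rwa [Ctx.labels_map_shift]) hl'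
  | conv _ hE ih => exact .conv ih (hE.rename _)

theorem CtxWf.bindT {S : Sig} {Γ : Ctx} {E : Eff} (h : CtxWf S 0 Γ E) (κ : Kind) :
    CtxWf S 0 (Γ.bindT κ) (Eff.rename Nat.succ E) :=
  .tvar h.shift

end Met

/-! ## The translation -/

namespace Transl

theorem row_rename (ρ : ℕ → ℕ) (E : Feps.Row) :
    row (E.rename ρ) = Met.Eff.rename ρ (row E) := by
  induction E <;> simp_all [Feps.Row.rename, row, Met.Eff.rename, Met.Atom.rename]

theorem ty_rename (ρ : ℕ → ℕ) (A : Feps.Ty) : ty (A.rename ρ) = (ty A).rename ρ := by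
  induction A generalizing ρ <;>
    simp_all [Feps.Ty.rename, ty, Met.Ty.rename, Met.Modality.rename, row_rename]

def subst (σ : Feps.Subst) : Met.Subst where
  ty i := ty (σ.ty i)
  eff i := row (σ.row i)

theorem subst_lift (σ : Feps.Subst) : subst σ.lift = (subst σ).lift := by
  simp only [subst, Met.Subst.lift, Met.Subst.mk.injEq]
  constructor <;> funext i <;> cases i
  · rfl
  · exact ty_rename _ _
  · rfl
  · exact row_rename _ _

theorem row_subst (σ : Feps.Subst) (E : Feps.Row) :
    row (E.subst σ) = Met.Eff.subst (subst σ) (row E) := by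
  induction E <;> simp_all [Feps.Row.subst, row, Met.Eff.subst, Met.Atom.subst, subst]

theorem ty_subst (σ : Feps.Subst) (A : Feps.Ty) : ty (A.subst σ) = (ty A).subst (subst σ) := by
  induction A generalizing σ with
  | unit => rfl
  | var i => rfl
  | arr A E B ihA ihB =>
    simp [Feps.Ty.subst, ty, Met.Ty.subst, Met.Modality.subst, row_subst, ihA, ihB]
  | all κ A ih => simp [Feps.Ty.subst, ty, Met.Ty.subst, ih, subst_lift]

theorem subst_toSubst (T : Feps.TyArg) : subst T.toSubst = (arg T).toSubst := by
  cases T <;> simp only [subst, arg, Met.TyArg.toSubst, Feps.TyArg.toSubst,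
    Met.Subst.mk.injEq] <;> constructor <;> funext i <;> cases i <;> rfl

theorem ty_inst (A : Feps.Ty) (T : Feps.TyArg) : ty (A.inst T) = (ty A).inst (arg T) := by
  rw [Feps.Ty.inst, Met.Ty.inst, ty_subst, subst_toSubst]

def rowLabels : Feps.Row → Met.Ext
  | .nil => []
  | .var _ => []
  | .cons l E => .lab l :: rowLabels E

def rowTail : Feps.Row → Met.Eff
  | .nil => []
  | .var i => [.evar i]
  | .cons _ E => rowTail E

theorem row_eq_append (E : Feps.Row) : row E = rowLabels E ++ rowTail E := by
  induction E <;> simp_all [row, rowLabels, rowTail]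

theorem rowTail_equiv_refl (E : Feps.Row) : Met.EffEquiv (rowTail E) (rowTail E) := by
  induction E with
  | nil => exact .nil
  | var i => exact .evar i
  | cons l E ih => exact ih

theorem rowLabels_equiv {E F : Feps.Row} (h : Feps.RowEquiv E F) :
    Met.ExtEquiv (rowLabels E) (rowLabels F) ∧ rowTail E = rowTail F := by
  induction h with
  | refl E => exact ⟨.refl _, rfl⟩
  | trans _ _ ih₁ ih₂ => exact ⟨.trans ih₁.1 ih₂.1, ih₁.2.trans ih₂.2⟩
  | cons l _ ih => exact ⟨.cons l ih.1, ih.2⟩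
  | swap E hl => exact ⟨.swap _ hl, rfl⟩

theorem row_equiv {E F : Feps.Row} (h : Feps.RowEquiv E F) : Met.EffEquiv (row E) (row F) := by
  obtain ⟨h₁, h₂⟩ := rowLabels_equiv h
  rw [row_eq_append E, row_eq_append F, ← h₂]
  exact .append h₁ (rowTail_equiv_refl E)

theorem ty_equiv {A B : Feps.Ty} (h : Feps.TyEquiv A B) : Met.TyEquiv (ty A) (ty B) := by
  induction h with
  | unit => exact .unit
  | var i => exact .var i
  | arr _ hE _ ihA ihB => exact .box (.abs (row_equiv hE)) (.arr ihA ihB)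
  | all κ _ ih => exact .all _ ih

theorem row_wf {Ω : Scope Feps.Kind} {Ω' : Scope Met.Kind} (h : Scope.Maps kind id Ω Ω')
    {E : Feps.Row} (hE : Feps.RowWf Ω E) : Met.EffWf Ω' (row E) := by
  induction hE with
  | nil => exact .nil
  | var hi => exact .evar (h.kinds _ _ hi)
  | cons hl _ ih => exact .cons (h.labels hl) ih

theorem ty_kind {Ω : Scope Feps.Kind} {Ω' : Scope Met.Kind} (h : Scope.Maps kind id Ω Ω')
    {A : Feps.Ty} (hA : Feps.TyWf Ω A) : Met.TyKind Ω' (ty A) .abs := by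
  induction hA generalizing Ω' with
  | unit => exact .unit
  | var hi => exact .var (h.kinds _ _ hi) (by simp)
  | arr _ hE _ ihA ihB =>
    exact .boxAbs (.abs (row_wf h hE)) (.arr (.sub (ihA h)) (.sub (ihB h)))
  | all _ ih => exact .all (ih (by simpa [liftRen_id] using h.push _))

theorem arg_kind {Ω : Scope Feps.Kind} {Ω' : Scope Met.Kind} (h : Scope.Maps kind id Ω Ω')
    {T : Feps.TyArg} {κ : Feps.Kind} (hT : Feps.ArgKind Ω T κ) :
    Met.ArgKind Ω' (arg T) (kind κ) := by
  cases hT with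
  | ty hA => exact .ty (ty_kind h hA)
  | row hE => exact .eff (row_wf h hE)

theorem sig_labels (S : Feps.Sig) : (sig S).map Prod.fst = S.map Prod.fst := by
  simp [sig, Function.comp_def]

theorem maps_scope {S : Feps.Sig} {k : ℕ} {Γ : Feps.Ctx} {Δ : Met.Ctx}
    (h : Met.Ctx.kinds Δ = (Feps.Ctx.kinds Γ).map kind) :
    Scope.Maps kind id (Feps.Ctx.scope S k Γ) (Met.Ctx.scope (sig S) k Δ) where
  labels := by simp [Feps.Ctx.scope, Met.Ctx.scope, sig_labels]
  kinds i κ hi := by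
    have e : (Met.Ctx.scope (sig S) k Δ).kinds =
        (Feps.Ctx.scope S k Γ).kinds.map (Option.map kind) := by
      simp [Met.Ctx.scope, Feps.Ctx.scope, h, Function.comp_def]
    unfold Scope.HasKind at hi ⊢
    simp [e, hi]

theorem sig_wf {S : Feps.Sig} (hS : Feps.SigWf S) : Met.SigWf (sig S) := by
  intro l A B h
  simp only [sig, List.mem_map, Prod.mk.injEq] at h
  obtain ⟨⟨l', A', B'⟩, h, rfl, rfl, rfl⟩ := h
  have hm := maps_scope (S := S) (k := 0) (Γ := []) (Δ := []) rfl
  exact ⟨ty_kind hm (hS _ _ _ h).1, ty_kind hm (hS _ _ _ h).2⟩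

theorem sig_mem {S : Feps.Sig} {l : Label} {A B : Feps.Ty} (h : (l, A, B) ∈ S) :
    (l, ty A, ty B) ∈ sig S :=
  List.mem_map_of_mem (f := fun e : Label × Feps.Ty × Feps.Ty => (e.1, ty e.2.1, ty e.2.2)) h

theorem kinds_ctx (F : Met.Eff) (Γ : Feps.Ctx) :
    Met.Ctx.kinds (ctx F Γ) = (Feps.Ctx.kinds Γ).map kind := by
  induction Γ with
  | nil => rfl
  | cons e Γ ih => cases e <;> simp_all [ctx, Met.Ctx.kinds, Feps.Ctx.kinds]

theorem ctx_wf {S : Feps.Sig} {k : ℕ} {Γ : Feps.Ctx} (h : Feps.CtxWf S k Γ) (F : Met.Eff) :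
    Met.CtxWf (sig S) k (ctx F Γ) F := by
  induction h with
  | nil => exact .nil
  | var _ hA ih => exact .var ih (ty_kind (maps_scope (kinds_ctx F _)) hA)
  | tvar _ ih => exact .tvar ih

/-- `Δ` has the type variables of `Γ` and, at the positions given by `ρ`, variables of the
translated types, under arbitrary modalities; locks and other variables may be interspersed. -/
structure Compat (Γ : Feps.Ctx) (Δ : Met.Ctx) (ρ : ℕ → ℕ) : Prop where
  kinds : Met.Ctx.kinds Δ = (Feps.Ctx.kinds Γ).map kind
  vars : ∀ i A, Γ.lookup i = some A → ∃ Δ₁ μ F Δ₂,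
    Δ = Δ₁ ++ Met.Entry.var μ F (ty A) :: Δ₂ ∧ Met.Ctx.numVars Δ₁ = ρ i

theorem Compat.lock {Γ : Feps.Ctx} {Δ : Met.Ctx} {ρ : ℕ → ℕ} (h : Compat Γ Δ ρ)
    (μ : Met.Modality) (F : Met.Eff) : Compat Γ (.lock μ F :: Δ) ρ where
  kinds := h.kinds
  vars i A hi := by
    obtain ⟨Δ₁, ν, G, Δ₂, rfl, e⟩ := h.vars i A hi
    exact ⟨.lock μ F :: Δ₁, ν, G, Δ₂, rfl, e⟩

theorem Compat.weaken {Γ : Feps.Ctx} {Δ : Met.Ctx} {ρ : ℕ → ℕ} (h : Compat Γ Δ ρ)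
    (μ : Met.Modality) (F : Met.Eff) (B : Met.Ty) :
    Compat Γ (.var μ F B :: Δ) (fun i => ρ i + 1) where
  kinds := h.kinds
  vars i A hi := by
    obtain ⟨Δ₁, ν, G, Δ₂, rfl, e⟩ := h.vars i A hi
    exact ⟨.var μ F B :: Δ₁, ν, G, Δ₂, rfl, by simp [Met.Ctx.numVars, e]⟩

theorem Compat.var {Γ : Feps.Ctx} {Δ : Met.Ctx} {ρ : ℕ → ℕ} (h : Compat Γ Δ ρ)
    (μ : Met.Modality) (F : Met.Eff) (B : Feps.Ty) :
    Compat (.var B :: Γ) (.var μ F (ty B) :: Δ) (liftRen ρ) where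
  kinds := h.kinds
  vars i A hi := by
    cases i with
    | zero =>
      simp only [Feps.Ctx.lookup, Option.some.injEq] at hi
      exact ⟨[], μ, F, Δ, by simp [hi], rfl⟩
    | succ i => exact (h.weaken μ F (ty B)).vars i A hi

theorem lookup_map_shift (Γ : Feps.Ctx) (i : ℕ) :
    Feps.Ctx.lookup (Γ.map Feps.Entry.shift) i = (Γ.lookup i).map (Feps.Ty.rename Nat.succ) := by
  induction Γ generalizing i with
  | nil => rfl
  | cons e Γ ih => cases e <;> cases i <;> simp_all [Feps.Ctx.lookup, Feps.Entry.shift]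

theorem Compat.bindT {Γ : Feps.Ctx} {Δ : Met.Ctx} {ρ : ℕ → ℕ} (h : Compat Γ Δ ρ)
    (κ : Feps.Kind) : Compat (Γ.bindT κ) (Δ.bindT (kind κ)) ρ where
  kinds := by
    simp [Feps.Ctx.bindT, Met.Ctx.bindT, Feps.Ctx.kinds, Met.Ctx.kinds,
      Feps.Ctx.kinds_map_shift, Met.Ctx.kinds_map_shift, h.kinds]
  vars i A hi := by
    rw [Feps.Ctx.bindT, Feps.Ctx.lookup, lookup_map_shift, Option.map_eq_some_iff] at hi
    obtain ⟨B, hB, rfl⟩ := hi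
    obtain ⟨Δ₁, μ, F, Δ₂, rfl, e⟩ := h.vars i B hB
    refine ⟨.tvar (kind κ) :: Δ₁.map Met.Entry.shift, μ.rename Nat.succ,
      Met.Eff.rename Nat.succ F, Δ₂.map Met.Entry.shift, ?_, ?_⟩
    · simp [Met.Ctx.bindT, Met.Entry.shift, ty_rename]
    · simp [Met.Ctx.numVars, Met.Ctx.numVars_map_shift, e]

theorem compat_ctx (F : Met.Eff) (Γ : Feps.Ctx) : Compat Γ (ctx F Γ) id where
  kinds := kinds_ctx F Γ
  vars i A hi := by
    induction Γ generalizing i with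
    | nil => simp [Feps.Ctx.lookup] at hi
    | cons e Γ ih =>
      cases e with
      | var B =>
        cases i with
        | zero =>
          simp only [Feps.Ctx.lookup, Option.some.injEq] at hi
          exact ⟨[], .one, F, ctx F Γ, by simp [hi, ctx], rfl⟩
        | succ i =>
          obtain ⟨Δ₁, μ, G, Δ₂, h, e⟩ := ih i hi
          exact ⟨.var .one F (ty B) :: Δ₁, μ, G, Δ₂, congrArg (List.cons _) h,
            by simp [Met.Ctx.numVars, e]⟩
      | tvar κ =>
        obtain ⟨Δ₁, μ, G, Δ₂, h, e⟩ := ih i (by simpa [Feps.Ctx.lookup] using hi)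
        exact ⟨.tvar (kind κ) :: Δ₁, μ, G, Δ₂, congrArg (List.cons _) h, e⟩

theorem Compat.scope_maps {Γ : Feps.Ctx} {Δ : Met.Ctx} {ρ : ℕ → ℕ} (h : Compat Γ Δ ρ)
    (S : Feps.Sig) : Scope.Maps kind id (Γ.scope S 0) (Δ.scope (sig S) 0) :=
  maps_scope h.kinds

theorem val_isValue {S : Feps.Sig} {Γ : Feps.Ctx} {V : Feps.Val} {A : Feps.Ty} :
    (d : Feps.ValTyping S Γ V A) → Met.IsValue (val d)
  | .unit _ => .unit
  | .var _ _ => .var _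
  | .lam _ => .mod _ (.lam _ _)
  | .tlam d => .tlam _ (val_isValue d)
  | .handler _ _ => .mod _ (.lam _ _)
  | .conv d _ _ => val_isValue d

end Transl

namespace Met

/-- The most recent variable is accessible if its type is of kind `Abs`. -/
theorem Typing.var_zero_abs {S : Sig} {Γ : Ctx} {μ : Modality} {F E : Eff} {A : Ty}
    (h : JudgWf S (.var μ F A :: Γ) A E) (hA : TyKind (Ctx.scope S 0 (.var μ F A :: Γ)) A .abs) :
    Typing S (.var μ F A :: Γ) (.var 0) A E :=
  Typing.var (Γ' := []) h (.inl hA)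

/-- A variable tagged with the absolute modality of the ambient effect context. -/
theorem Typing.var_zero_absolute {S : Sig} {Γ : Ctx} {E : Eff} {A : Ty}
    (h : JudgWf S (.var (.abs E) E A :: Γ) A E) :
    Typing S (.var (.abs E) E A :: Γ) (.var 0) A E :=
  Typing.var (Γ' := []) h (.inr (.abs h.eff.subEff_refl))

end Met

namespace Transl

/-- The return clause has the expected type in any context. -/
theorem retClause_typing {S : Met.Sig} {Δ : Met.Ctx} {l : Label} {E : Feps.Row} {A : Met.Ty}
    (hS : Met.SigWf S) (hΔ : Met.CtxWf S 0 Δ (row E))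
    (hE : Met.EffWf (Δ.scope S 0) (row E)) (hl : l ∈ (Δ.scope S 0).labels)
    (hA : Met.TyKind (Δ.scope S 0) A .abs) :
    Met.Typing S (.var .one (row E) (.box (.abs (row (.cons l E))) A) :: Δ) (retClause l E) A
      (row E) := by
  have hbox : Met.TyKind (Δ.scope S 0) (.box (.abs (row (.cons l E))) A) .abs :=
    .boxAbs (.abs (hE.cons hl)) (.sub hA)
  have hx : Met.CtxWf S 0 (.var .one (row E) (.box (.abs (row (.cons l E))) A) :: Δ) (row E) :=
    .var hΔ hbox
  refine .letmod (A := A) ⟨hS, hx, hE, .sub hA⟩ (.var 0) ?_ ?_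
  · exact Met.Typing.var (Γ' := [.lock .one (row E)]) ⟨hS, .lock hx, hE, .sub hbox⟩ (.inl hbox)
  · exact .var_zero_abs ⟨hS, .var hx hA, hE, .sub hA⟩ hA

/-- Handlers for translated clauses. -/
theorem handle_typing {S : Met.Sig} {Δ : Met.Ctx} {l : Label} {E : Feps.Row}
    {A A' B' : Met.Ty} {M N : Met.Term}
    (hS : Met.SigWf S) (hΔ : Met.CtxWf S 0 Δ (row E))
    (hE : Met.EffWf (Δ.scope S 0) (row E)) (hl : (l, A', B') ∈ S)
    (hA : Met.TyKind (Δ.scope S 0) A .abs)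
    (hM : Met.Typing S (.lock (.ext [.lab l]) (row E) :: .lock (.abs (row E)) (row E) :: Δ) M A
      (row (.cons l E)))
    (hN : Met.Typing S (.var .one (row E) (.box (.abs (row E)) (.arr B' A)) ::
      .var .one (row E) A' :: .lock (.abs (row E)) (row E) :: Δ) N A (row E)) :
    Met.Typing S Δ (.handle (.abs (row E)) M (retClause l E) l N) A (row E) := by
  have hl' : l ∈ (Δ.scope S 0).labels := List.mem_append_right _ (List.mem_map_of_mem hl)
  exact .handle (E := row E) ⟨hS, hΔ, hE, .sub hA⟩ rfl (.abs hE.subEff_refl)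
    (.abs hE.subEff_refl) hM (.inl hl) (retClause_typing hS (.lock hΔ) hE hl' hA) hN

set_option maxHeartbeats 4000000 in
mutual

theorem val_typing {S : Feps.Sig} (hS : Feps.SigWf S) {Γ : Feps.Ctx} {V : Feps.Val}
    {A : Feps.Ty} (d : Feps.ValTyping S Γ V A) {Δ : Met.Ctx} {ρ : ℕ → ℕ} {F : Met.Eff}
    (hc : Compat Γ Δ ρ) (hΔ : Met.CtxWf (sig S) 0 Δ F)
    (hF : Met.EffWf (Δ.scope (sig S) 0) F) :
    Met.Typing (sig S) Δ ((val d).rename ρ) (ty A) F := by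
  have hS' := sig_wf hS
  have hm := hc.scope_maps S
  have hA := ty_kind hm (d.regular hS).2
  have hJ : Met.JudgWf (sig S) Δ (ty A) F := ⟨hS', hΔ, hF, .sub hA⟩
  cases d with
  | unit _ => exact .unit hJ
  | @var _ i _ _ hi =>
    obtain ⟨Δ₁, μ, G, Δ₂, rfl, e⟩ := hc.vars i A hi
    rw [val, Met.Term.rename, ← e]
    exact .var hJ (.inl hA)
  | @lam _ A B E M d =>
    obtain ⟨hΓ, hB, hE⟩ := d.regular hS
    cases hΓ with
    | var hΓ hA =>
      have hE' := row_wf hm hE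
      have hA' := ty_kind hm hA
      have hB' := ty_kind hm hB
      rw [val]
      refine .mod hJ (.lam _ _) (.lam ⟨hS', .lock hΔ, hE', .arr (.sub hA') (.sub hB')⟩ ?_)
      exact comp_typing hS d ((hc.lock _ _).var _ _ _) (.var (.lock hΔ) hA') hE'
  | @tlam _ κ V A d =>
    rw [val]
    exact .tlam hJ ((val_isValue d).rename _) (val_typing hS d (hc.bindT κ) (hΔ.bindT _)
      (hF.rename (Met.Ctx.maps_bindT _ _ _)))
  | @handler _ l A' B' A E N hl d =>
    obtain ⟨hΓ, hA, hE⟩ := d.regular hS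
    cases hΓ with
    | var hΓ hr =>
      cases hΓ with
      | var hΓ hp =>
        have hE' := row_wf hm hE
        have hA' := ty_kind hm hA
        have hr' := ty_kind hm hr
        have hp' := ty_kind hm hp
        have hl' : l ∈ (Δ.scope (sig S) 0).labels :=
          List.mem_append_right _ (List.mem_map_of_mem (sig_mem hl))
        have hlE := hE'.cons hl'
        have hfun : Met.TyKind (Δ.scope (sig S) 0) (.arr .unit (ty A)) .any :=
          .arr (.sub .unit) (.sub hA')
        have hf : Met.TyKind (Δ.scope (sig S) 0) (ty (.arr .unit (.cons l E) A)) .abs :=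
          .boxAbs (.abs hlE) hfun
        have hctx : Met.CtxWf (sig S) 0 (.var .one (row E) (ty (.arr .unit (.cons l E) A)) ::
            .lock (.abs (row E)) F :: Δ) (row E) := .var (.lock hΔ) hf
        have hctx' := (hctx.lock (μ := .abs (row E))).lock (μ := .ext [.lab l])
        rw [val]
        refine .mod hJ (.lam _ _) (.lam ⟨hS', .lock hΔ, hE', .arr (.sub hf) (.sub hA')⟩ ?_)
        refine handle_typing hS' hctx hE' (sig_mem hl) hA' ?_ ?_
        · refine .letmod (A := .arr .unit (ty A)) ⟨hS', hctx', hlE, .sub hA'⟩ (.var 0) ?_ ?_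
          · exact Met.Typing.var (Γ' := [.lock .one (row (.cons l E)),
              .lock (.ext [.lab l]) (row E), .lock (.abs (row E)) (row E)])
              ⟨hS', hctx'.lock, hlE, .sub hf⟩ (.inl hf)
          · refine .app (A := .unit) ⟨hS', .var hctx' hfun, hlE, .sub hA'⟩ ?_
              (.unit ⟨hS', .var hctx' hfun, hlE, .sub .unit⟩)
            exact .var_zero_absolute ⟨hS', .var hctx' hfun, hlE, hfun⟩
        · rw [Met.Term.rename_rename, liftRen_comp, liftRen_comp]
          exact comp_typing hS d
            (((((hc.lock _ _).weaken _ _ _).lock _ _).var _ _ _).var _ _ _)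
            (.var (.var hctx.lock hp') hr') hE'
  | conv d hAB hB =>
    exact .conv hJ (val_typing hS d hc hΔ hF) (ty_equiv hAB) hF.equiv_refl

theorem comp_typing {S : Feps.Sig} (hS : Feps.SigWf S) {Γ : Feps.Ctx} {M : Feps.Comp}
    {A : Feps.Ty} {E : Feps.Row} (d : Feps.CompTyping S Γ M A E) {Δ : Met.Ctx} {ρ : ℕ → ℕ}
    (hc : Compat Γ Δ ρ) (hΔ : Met.CtxWf (sig S) 0 Δ (row E))
    (hF : Met.EffWf (Δ.scope (sig S) 0) (row E)) :
    Met.Typing (sig S) Δ ((comp d).rename ρ) (ty A) (row E) := by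
  have hS' := sig_wf hS
  have hm := hc.scope_maps S
  have hA := ty_kind hm (d.regular hS).2.1
  have hJ : Met.JudgWf (sig S) Δ (ty A) (row E) := ⟨hS', hΔ, hF, .sub hA⟩
  cases d with
  | ret d _ => exact val_typing hS d hc hΔ hF
  | @letin _ M N A B E d e =>
    have hA' := ty_kind hm (d.regular hS).2.1
    rw [comp]
    refine .app hJ (.lam ⟨hS', hΔ, hF, .arr (.sub hA') (.sub hA)⟩ ?_)
      (comp_typing hS d hc hΔ hF)
    exact comp_typing hS e (hc.var _ _ _) (.var hΔ hA') hF
  | @app _ V W A₀ _ _ d e =>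
    have hA' := ty_kind hm (e.regular hS).2
    have hfun : Met.TyKind (Δ.scope (sig S) 0) (.arr (ty A₀) (ty A)) .any :=
      .arr (.sub hA') (.sub hA)
    have hctx : Met.CtxWf (sig S) 0 (.var (.abs (row E)) (row E) (.arr (ty A₀) (ty A)) :: Δ)
      (row E) := .var hΔ hfun
    rw [comp]
    refine .letmod (A := .arr (ty A₀) (ty A)) hJ ((val_isValue d).rename _)
      (val_typing hS d (hc.lock _ _) (.lock hΔ) hF) ?_
    refine .app ⟨hS', hctx, hF, .sub hA⟩ (.var_zero_absolute ⟨hS', hctx, hF, hfun⟩) ?_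
    rw [Met.Term.rename_rename]
    exact val_typing hS e (hc.weaken _ _ _) hctx hF
  | @tapp _ V κ B T E d hT hE =>
    rw [comp]
    rw [ty_inst] at hJ ⊢
    exact .tapp hJ (val_typing hS d hc hΔ hF) (arg_kind hm hT)
  | perform hl d hE =>
    rw [comp]
    exact .perform hJ (.inl (sig_mem hl)) (val_typing hS d hc hΔ hF)
  | @handle _ l A' B' A E M N hl d e =>
    have hΓ := (e.regular hS).1
    cases hΓ with
    | var hΓ hr =>
      cases hΓ with
      | var hΓ hp =>
        have hl' : l ∈ (Δ.scope (sig S) 0).labels :=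
          List.mem_append_right _ (List.mem_map_of_mem (sig_mem hl))
        rw [comp]
        refine handle_typing hS' hΔ hF (sig_mem hl) hA ?_ ?_
        · exact comp_typing hS d ((hc.lock _ _).lock _ _)
            ((hΔ.lock (μ := .abs (row E))).lock (μ := .ext [.lab l])) (hF.cons hl')
        · exact comp_typing hS e (((hc.lock _ _).var _ _ _).var _ _ _)
            (.var (.var hΔ.lock (ty_kind hm hp)) (ty_kind hm hr)) hF
  | conv d hAB hEF hB hF' =>
    have hE' := row_wf hm (d.regular hS).2.2
    exact .conv hJ (comp_typing hS d hc (.conv hΔ (row_equiv hEF).symm) hE') (ty_equiv hAB)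
      (row_equiv hEF)

end

end Transl

theorem mainTheorem3 (S : Feps.Sig) (hS : Feps.SigWf S) :
    (∀ (Γ : Feps.Ctx) (M : Feps.Comp) (A : Feps.Ty) (E : Feps.Row)
        (d : Feps.CompTyping S Γ M A E),
      Met.Typing (Transl.sig S) (Transl.ctx (Transl.row E) Γ) (Transl.comp d)
        (Transl.ty A) (Transl.row E)) ∧
    (∀ (Γ : Feps.Ctx) (V : Feps.Val) (A : Feps.Ty) (d : Feps.ValTyping S Γ V A)
        (E : Feps.Row), Feps.RowWf (Γ.scope S 0) E →
      Met.Typing (Transl.sig S) (Transl.ctx (Transl.row E) Γ) (Transl.val d)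
        (Transl.ty A) (Transl.row E)) := by
  refine ⟨fun Γ M A E d => ?_, fun Γ V A d E hE => ?_⟩
  · have h := Transl.compat_ctx (Transl.row E) Γ
    obtain ⟨hΓ, _, hE⟩ := d.regular hS
    simpa [Met.Term.rename_id] using
      Transl.comp_typing hS d h (Transl.ctx_wf hΓ _) (Transl.row_wf (h.scope_maps S) hE)
  · have h := Transl.compat_ctx (Transl.row E) Γ
    simpa [Met.Term.rename_id] using
      Transl.val_typing hS d h (Transl.ctx_wf (d.regular hS).1 _)
        (Transl.row_wf (h.scope_maps S) hE)
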